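/- Let $G=(V,E)$ be a finite simple graph on $n$ vertices and, for $c\in\mathbb R^{E}$, let $P(G,c)$ be the problem of finding a positive semidefinite matrix $X\in\mathbb R^{V\times V}$ with $X[i,i]=1$ for all $i\in V$ and $X[i,j]=c(ij)$ for all $ij\in E$. For $\omega\in\mathbb R^{V\cup E}$ let $\Omega$ be the symmetric matrix with diagonal entries $\omega(i)$, with entries $\omega(ij)/2$ at the positions of the edges $ij$, and with all other entries $0$. When $P(G,c)$ is feasible, let $\mathrm{sd}(G,c)$ be the smallest $k\ge 0$ for which there are $\omega^1,\dots,\omega^k\in\mathbb R^{V\cup E}$ such that, with $\mathcal V^j=\{x\in\mathbb R^V: x^{\top}\Omega^i x=0\ (i=1,\dots,j)\}$ (so $\mathcal V^0=\mathbb R^V$), 1. $x^\top\Omega^j x\ge 0$ for all $x\in\mathcal V^{j-1}$ and $j=1,\dots,k$; 2. $\sum_{i\in V}\omega^j(i)+\sum_{ij\in E}\omega^j(ij)c(ij)\le 0$ for $j=1,\dots,k$; 3. $\dim\mathcal V^k$ is the rank of a relative interior point of the feasible set of $P(G,c)$. (Thus $\mathrm{sd}(G,c)=0$ if and only if $P(G,c)$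 has a positive definite solution.) The singularity degree $\mathrm{sd}(G)$ is the maximum of $\mathrm{sd}(G,c)$ over all $c$ for which $P(G,c)$ is feasible. For every integer $n\ge 4$ there is a graph $G$ on $n$ vertices whose treewidth is exactly $3$ and whose singularity degree satisfies $\mathrm{sd}(G)\ge\lfloor (n-1)/3\rfloor$. In particular $\mathrm{sd}$ admits no sublinear bound in the number of vertices: there is no function $f:\mathbb N\to\mathbb R$ with $f(n)=o(n)$ as $n\to\infty$ such that $\mathrm{sd}(G)\le f(n)$ for all $n$ and all graphs $G$ on $n$ vertices. -/

import Mathlib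

namespace PSDCompletion

open Matrix
open scoped Classical

section Treewidth

/-- A tree decomposition of `G` whose tree has the nodes `0, …, m - 1`: every vertex and every edge
of `G` lies in a bag, and for each vertex the nodes whose bags contain it induce a connected
subgraph of the tree. -/
structure TreeDecomposition {V : Type*} (G : SimpleGraph V) (m : ℕ) where
  tree : SimpleGraph (Fin m)
  isTree : tree.IsTree
  bag : Fin m → Finset V
  vertex_mem : ∀ v : V, ∃ t, v ∈ bag t
  edge_mem : ∀ u v : V, G.Adj u v → ∃ t, u ∈ bag t ∧ v ∈ bag t
  connected : ∀ v : V, (tree.induce {t | v ∈ bag t}).Connected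

/-- The treewidth of a (nonempty, finite) graph: the least `w` such that some tree decomposition
has all its bags of size at most `w + 1`. -/
noncomputable def treewidth {V : Type*} (G : SimpleGraph V) : ℕ :=
  sInf {w : ℕ | ∃ (m : ℕ) (D : TreeDecomposition G m), ∀ t, (D.bag t).card ≤ w + 1}

end Treewidth

section SingularityDegree

variable {V : Type*} [Fintype V]

/-- The elliptope: positive semidefinite matrices with unit diagonal. -/
def elliptope (V : Type*) [Fintype V] : Set (Matrix V V ℝ) :=
  {X | X.PosSemidef ∧ ∀ i, X i i = 1}

/-- The feasible set of the completion problem `P(G, c)`: positive semidefinite matrices with unit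
diagonal whose entry at each edge `ij` of `G` equals `c(ij)`. -/
def feasibleSet (G : SimpleGraph V) (c : G.edgeSet → ℝ) : Set (Matrix V V ℝ) :=
  {X | X ∈ elliptope V ∧
    ∀ (i j : V) (h : G.Adj i j), X i j = c ⟨s(i, j), G.mem_edgeSet.2 h⟩}

/-- The coordinate shadow `𝓔(G)` of the elliptope: the edge weights `c` for which `P(G, c)` is
feasible. Such weights automatically take values in `[-1, 1]`. -/
def coordinateShadow (G : SimpleGraph V) : Set (G.edgeSet → ℝ) :=
  {c | (feasibleSet G c).Nonempty}

/-- The matrix `Ω = ∑ i, ω(i) E_ii + ∑ ij, ω(ij) E_ij` of `ω ∈ ℝ^(V ∪ E)`, where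
`E_ij = (e_i e_jᵀ + e_j e_iᵀ) / 2`. -/
noncomputable def stressMatrix (G : SimpleGraph V) (ω : V ⊕ G.edgeSet → ℝ) : Matrix V V ℝ :=
  Matrix.of fun i j =>
    if i = j then ω (Sum.inl i)
    else if h : G.Adj i j then ω (Sum.inr ⟨s(i, j), G.mem_edgeSet.2 h⟩) / 2
    else 0

/-- The objective value `∑ i, ω(i) + ∑ ij, ω(ij) c(ij)` of the dual problem. -/
noncomputable def dualValue (G : SimpleGraph V) (c : G.edgeSet → ℝ) (ω : V ⊕ G.edgeSet → ℝ) : ℝ :=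
  ∑ i : V, ω (Sum.inl i) + ∑ e : G.edgeSet, ω (Sum.inr e) * c e

/-- For a sequence `Y¹, …, Yᵏ` of matrices (indexed from `0` here), the set
`𝒱ʲ = {x | xᵀ Yⁱ x = 0 for i = 1, …, j}`; so `𝒱⁰` is the whole space. For nested PSD sequences
`𝒱ʲ` is a linear subspace. -/
def nullSet {k : ℕ} (Y : Fin k → Matrix V V ℝ) (j : ℕ) : Set (V → ℝ) :=
  {x | ∀ i : Fin k, (i : ℕ) < j → x ⬝ᵥ (Y i *ᵥ x) = 0}

/-- The sequence `Y¹, …, Yᵏ` is nested PSD: each `Yⁱ` is positive semidefinite on `𝒱ⁱ⁻¹`. -/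
def IsNestedPSD {k : ℕ} (Y : Fin k → Matrix V V ℝ) : Prop :=
  ∀ i : Fin k, ∀ x ∈ nullSet Y i, 0 ≤ x ⬝ᵥ (Y i *ᵥ x)

/-- `ω¹, …, ωᵏ` is a complete facial reduction sequence for `P(G, c)`: the matrices `Ωʲ` are nested
PSD, each `ωʲ` has dual value at most `0`, and the rank `n - dim 𝒱ᵏ` of the sequence is `n - s`,
where `s` is the rank of a (relative) interior point of the feasible set. There is no sign
condition on the `ωʲ` because all the constraints of `P(G, c)` are equations. -/
structure IsFacialReduction (G : SimpleGraph V) (c : G.edgeSet → ℝ) {k : ℕ}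
    (ω : Fin k → V ⊕ G.edgeSet → ℝ) : Prop where
  nested : IsNestedPSD fun j => stressMatrix G (ω j)
  dualValue_nonpos : ∀ j, dualValue G c (ω j) ≤ 0
  rank_eq : ∃ X ∈ intrinsicInterior ℝ (feasibleSet G c),
    Set.finrank ℝ (nullSet (fun j => stressMatrix G (ω j)) k) = X.rank

/-- The singularity degree `sd(G, c)` of `P(G, c)`: the smallest length of a complete facial
reduction sequence. Such sequences exist whenever `P(G, c)` is feasible, and the empty sequence is
one exactly if `P(G, c)` has a positive definite solution. -/
noncomputable def sdWeight (G : SimpleGraph V) (c : G.edgeSet → ℝ) : ℕ :=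
  sInf {k : ℕ | ∃ ω : Fin k → V ⊕ G.edgeSet → ℝ, IsFacialReduction G c ω}

/-- The singularity degree `sd(G)`: the largest value of `sd(G, c)` over the feasible edge weights
`c ∈ 𝓔(G)`. These values are at most the number of vertices. -/
noncomputable def sd (G : SimpleGraph V) : ℕ :=
  sSup {d : ℕ | ∃ c ∈ coordinateShadow G, d = sdWeight G c}

end SingularityDegree

end PSDCompletion

/-! The weights come from unit vectors: a hub `h` and `k` triangles `a_i, b_i, z_i`, all triangle
edges having weight -1/2, so that `a_i + b_i + z_i = 0` in every solution. The edge from `h` to the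
first `z` has weight 1, which forces these two to coincide. The edges from `h` to `a_i` and from
`z_{i-1}` to `b_i` have weight -1/2; once `z_{i-1} = h`, also `h + a_i + b_i = 0`, and therefore
`z_i = h`. Since a later `b_i` sees `h` only through `z_{i-1}`, the coincidences propagate one
triangle at a time.

`chainSpace k e j` imposes all triangle and pendant relations and the first `j` coincidences. The
heart is `dotProduct_mulVec_eq_zero_of_step`: if the current null space contains `chainSpace k e j`,
the next one still contains `chainSpace k e (j + 1)`. Nonpositive dual value makes the axis and spin
vectors isotropic, hence orthogonal to the current null space, and the sparsity of the stress matrix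
then annihilates the form on the later triangles. A complete sequence must reach the dimension of
`chainSpace k e k` (`rank_eq_finrank_chainSpace`), so it has at least `k` steps.

An infimum over an empty set of naturals is 0, so some complete sequence must also be exhibited
(`isReducedTo_chainSpace`); the supremum defining `sd` needs the bound `sdWeight_le_card`. The
treewidth is 3 because the graph contains a `K₄` and lies in the cone over the square of a path. -/

namespace PSDCompletion

open Matrix
open scoped Classical

/-! ### Medians and the Helly property in trees. -/

section TreeHelly

variable {T : Type*} {G : SimpleGraph T}

/-- A set of vertices containing every path between two of its members. -/
def PathClosed (G : SimpleGraph T) (S : Set T) : Prop :=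
  ∀ ⦃u v : T⦄ (p : G.Walk u v), p.IsPath → u ∈ S → v ∈ S → ∀ x ∈ p.support, x ∈ S

theorem PathClosed.inter {S S' : Set T} (h : PathClosed G S) (h' : PathClosed G S') :
    PathClosed G (S ∩ S') := fun _ _ p hp hu hv x hx =>
  ⟨h p hp hu.1 hv.1 x hx, h' p hp hu.2 hv.2 x hx⟩

theorem pathClosed_of_connected (hG : G.IsAcyclic) {S : Set T} (hS : (G.induce S).Connected) :
    PathClosed G S := by
  intro u v p hp hu hv x hx
  obtain ⟨q, hq⟩ := (hS.preconnected ⟨u, hu⟩ ⟨v, hv⟩).exists_isPath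
  let f : G.induce S →g G := (SimpleGraph.Embedding.induce S).toHom
  have hf : Function.Injective f := fun a b h => Subtype.ext h
  have hq' : (q.map f).IsPath := SimpleGraph.Walk.IsPath.map hf hq
  have := (hG.subsingleton_path u v).elim ⟨p, hp⟩ ⟨q.map f, hq'⟩
  have hpq : p = q.map f := congrArg Subtype.val this
  have hx' : x ∈ (q.map f).support := by rw [hpq] at hx; exact hx
  rw [SimpleGraph.Walk.support_map, List.mem_map] at hx'
  obtain ⟨y, -, rfl⟩ := hx'
  exact y.2

/-- Induction on `q`: prepending a vertex `w` to `q` either extends the path `s`, or `s` already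
meets `w` and is cut there. The median survives unless it lies in the part cut off. -/
theorem exists_median (hG : G.IsAcyclic) {u v w : T} (p : G.Walk u v) (hp : p.IsPath)
    (q : G.Walk w u) :
    ∃ m, m ∈ p.support ∧ m ∈ q.support ∧ ∃ s : G.Walk w v, s.IsPath ∧ m ∈ s.support := by
  classical
  induction q with
  | nil => exact ⟨_, p.start_mem_support, by simp, p, hp, p.start_mem_support⟩
  | @cons w w' u h q ih =>
    obtain ⟨m, hmp, hmq, s, hs, hms⟩ := ih p hp
    by_cases hw : w ∈ s.support
    · by_cases hm : m ∈ (s.dropUntil w hw).support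
      · exact ⟨m, hmp, by simp [hmq], s.dropUntil w hw, hs.dropUntil hw, hm⟩
      · have hwd : w ∈ (s.dropUntil m hms).support := by
          by_contra hwd
          have h1 : w ∈ (s.takeUntil m hms).support := by
            have := hw
            rw [← s.take_spec hms, SimpleGraph.Walk.mem_support_append_iff] at this
            tauto
          have h2 : s = ((s.takeUntil m hms).takeUntil w h1).append
              (((s.takeUntil m hms).dropUntil w h1).append (s.dropUntil m hms)) := by
            rw [SimpleGraph.Walk.append_assoc, SimpleGraph.Walk.take_spec,
              SimpleGraph.Walk.take_spec]
          have h3 : (((s.takeUntil m hms).dropUntil w h1).append (s.dropUntil m hms)).IsPath := by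
            rw [h2] at hs
            exact hs.of_append_right
          have h4 := (hG.subsingleton_path w v).elim ⟨_, hs.dropUntil hw⟩ ⟨_, h3⟩
          have h5 : s.dropUntil w hw =
              ((s.takeUntil m hms).dropUntil w h1).append (s.dropUntil m hms) :=
            congrArg Subtype.val h4
          apply hm
          rw [h5, SimpleGraph.Walk.mem_support_append_iff]
          exact Or.inr (SimpleGraph.Walk.start_mem_support _)
        -- After `m`, both `s` and `p` follow the unique path to `v`; so `w` lies on `p` and is the
        -- new median.
        have := (hG.subsingleton_path m v).elim ⟨_, hs.dropUntil hms⟩ ⟨_, hp.dropUntil hmp⟩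
        have h7 : s.dropUntil m hms = p.dropUntil m hmp := congrArg Subtype.val this
        refine ⟨w, ?_, by simp, s.dropUntil w hw, hs.dropUntil hw, by simp⟩
        rw [h7] at hwd
        exact SimpleGraph.Walk.support_dropUntil_subset_support _ _ hwd
    · exact ⟨m, hmp, by simp [hmq], s.cons h, by simp [hs, hw], by simp [hms]⟩

/-- The median of one point from each pairwise intersection lies on the three connecting paths, each
of which stays in one of the sets. -/
theorem helly_three (hG : G.IsTree) {A B C : Set T} (hA : PathClosed G A) (hB : PathClosed G B)
    (hC : PathClosed G C) (hAB : (A ∩ B).Nonempty) (hAC : (A ∩ C).Nonempty)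
    (hBC : (B ∩ C).Nonempty) : (A ∩ B ∩ C).Nonempty := by
  obtain ⟨u, huA, huB⟩ := hAB
  obtain ⟨v, hvB, hvC⟩ := hBC
  obtain ⟨w, hwA, hwC⟩ := hAC
  obtain ⟨p, hp⟩ := (hG.connected.preconnected u v).exists_isPath
  obtain ⟨q, hq⟩ := (hG.connected.preconnected w u).exists_isPath
  obtain ⟨m, hmp, hmq, s, hs, hms⟩ := exists_median hG.isAcyclic p hp q
  exact ⟨m, ⟨hA q hq hwA huA m hmq, hB p hp huB hvB m hmp⟩, hC s hs hwC hvC m hms⟩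

theorem helly_four (hG : G.IsTree) {A : Fin 4 → Set T} (hA : ∀ i, PathClosed G (A i))
    (h : ∀ i j, (A i ∩ A j).Nonempty) : ∃ t, ∀ i, t ∈ A i := by
  obtain ⟨t, ⟨⟨h0, h1⟩, h2⟩, h3⟩ := helly_three hG ((hA 0).inter (hA 1)) (hA 2) (hA 3)
    (helly_three hG (hA 0) (hA 1) (hA 2) (h 0 1) (h 0 2) (h 1 2))
    (helly_three hG (hA 0) (hA 1) (hA 3) (h 0 1) (h 0 3) (h 1 3)) (h 2 3)
  exact ⟨t, fun i => by fin_cases i <;> assumption⟩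

end TreeHelly

/-! ### Treewidth: cliques from below, path decompositions from above. -/

section TreewidthBounds

/-- The subtrees of four mutually adjacent vertices meet pairwise, so by the Helly property some bag
contains all four. `hne` excludes the infimum of an empty set. -/
theorem three_le_treewidth {V : Type*} {G : SimpleGraph V} (K : Fin 4 → V)
    (hK : Function.Injective K) (hadj : ∀ i j, i ≠ j → G.Adj (K i) (K j))
    (hne : ∃ (w m : ℕ) (D : TreeDecomposition G m), ∀ t, (D.bag t).card ≤ w + 1) :
    3 ≤ treewidth G := by
  refine le_csInf hne ?_
  rintro w ⟨m, D, hD⟩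
  obtain ⟨t, ht⟩ := helly_four (A := fun i => {t | K i ∈ D.bag t}) D.isTree
    (fun i => pathClosed_of_connected D.isTree.isAcyclic (D.connected _)) (fun i j => by
      by_cases hij : i = j
      · subst hij
        obtain ⟨t, ht⟩ := D.vertex_mem (K i)
        exact ⟨t, ht, ht⟩
      · exact D.edge_mem _ _ (hadj i j hij))
  have h4 : (Finset.univ.map ⟨K, hK⟩).card ≤ (D.bag t).card :=
    Finset.card_le_card fun x hx => by
      obtain ⟨i, -, rfl⟩ := Finset.mem_map.1 hx
      exact ht i
  simp only [Finset.card_map, Finset.card_univ, Fintype.card_fin] at h4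
  have := hD t
  omega

theorem pathGraph_isTree (m : ℕ) : (SimpleGraph.pathGraph (m + 1)).IsTree := by
  refine ⟨SimpleGraph.pathGraph_connected m, ?_⟩
  have key : ∀ v w : Fin (m + 1), (v : ℕ) + 1 = w →
      (SimpleGraph.pathGraph (m + 1)).IsBridge s(v, w) := by
    intro v w hvw
    rw [SimpleGraph.isBridge_iff]
    rintro ⟨p⟩
    -- Without the edge `vw`, no walk crosses from the vertices up to `v` to those beyond.
    have : ∀ (x y : Fin (m + 1))
        (q : ((SimpleGraph.pathGraph (m + 1)).deleteEdges {s(v, w)}).Walk x y),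
        x ≤ v → y ≤ v := by
      intro x y q
      induction q with
      | nil => exact id
      | @cons x x' y h q ih =>
        intro hx
        apply ih
        rw [SimpleGraph.deleteEdges_adj, SimpleGraph.pathGraph_adj] at h
        by_contra hlt
        have h1 : x = v := Fin.ext (by have := h.1; simp only [Fin.le_def] at hx hlt; omega)
        have h2 : x' = w := Fin.ext (by have := h.1; simp only [Fin.le_def] at hx hlt; omega)
        exact h.2 (by simp [h1, h2])
    have := this v w p le_rfl
    simp only [Fin.le_def] at this
    omega
  rw [SimpleGraph.isAcyclic_iff_forall_adj_isBridge]
  intro v w h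
  rw [SimpleGraph.pathGraph_adj] at h
  rcases h with h | h
  · exact key v w h
  · rw [Sym2.eq_swap]; exact key w v h

theorem pathGraph_induce_ordConnected {m : ℕ} {S : Set (Fin m)} (hne : S.Nonempty)
    (hS : S.OrdConnected) : ((SimpleGraph.pathGraph m).induce S).Connected := by
  have key : ∀ (d : ℕ) (x y : S), (y.1 : ℕ) = x.1 + d →
      ((SimpleGraph.pathGraph m).induce S).Reachable x y := by
    intro d
    induction d with
    | zero =>
      intro x y h
      have : x = y := Subtype.ext (Fin.ext (by omega))
      rw [this]
    | succ d ih =>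
      intro x y h
      have hlt : (x.1 : ℕ) + d < m := by have := y.1.2; omega
      have hz : (⟨x.1 + d, hlt⟩ : Fin m) ∈ S :=
        hS.out x.2 y.2 ⟨by simp [Fin.le_def], by simp only [Fin.le_def]; omega⟩
      refine (ih x ⟨_, hz⟩ rfl).trans (SimpleGraph.Adj.reachable ?_)
      simp only [SimpleGraph.comap_adj, SimpleGraph.pathGraph_adj, Function.Embedding.subtype_apply]
      omega
  have : Nonempty S := hne.to_subtype
  refine ⟨fun x y => ?_⟩
  rcases le_total (x.1 : ℕ) y.1 with h | h
  · exact key (y.1 - x.1) x y (by omega)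
  · exact (key (x.1 - y.1) y x (by omega)).symm

/-- Graphs contained in the cone over the square of a path have a path decomposition into bags of
size four. -/
theorem exists_treeDecomposition_of_band {n : ℕ} (hn : 4 ≤ n) (G : SimpleGraph (Fin n))
    (hG : ∀ u v, G.Adj u v → u < v → (u : ℕ) = 0 ∨ (v : ℕ) ≤ u + 2) :
    ∃ (m : ℕ) (D : TreeDecomposition G m), ∀ t, (D.bag t).card ≤ 3 + 1 := by
  -- Node `t` carries the bag `{0, t+1, t+2, t+3}`; an edge is placed at the node where its larger
  -- end comes last, or at node 0 if that end is below 3.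
  have hvert : ∀ v : Fin n, ∃ t : Fin (n - 4 + 1), (v : ℕ) = 0 ∨ (t : ℕ) + 1 ≤ v ∧ (v : ℕ) ≤ t + 3 := by
    intro v
    rcases Nat.lt_or_ge v 3 with h | h
    · exact ⟨⟨0, by omega⟩, by simp only; omega⟩
    · exact ⟨⟨v - 3, by omega⟩, by simp only; omega⟩
  have hedge : ∀ u v, G.Adj u v → u < v → ∃ t : Fin (n - 4 + 1),
      ((u : ℕ) = 0 ∨ (t : ℕ) + 1 ≤ u ∧ (u : ℕ) ≤ t + 3) ∧
      ((v : ℕ) = 0 ∨ (t : ℕ) + 1 ≤ v ∧ (v : ℕ) ≤ t + 3) := by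
    intro u v h huv
    have := hG u v h huv
    rw [Fin.lt_def] at huv
    rcases Nat.lt_or_ge v 3 with h | h
    · exact ⟨⟨0, by omega⟩, by simp only; omega⟩
    · exact ⟨⟨v - 3, by omega⟩, by simp only; omega⟩
  refine ⟨n - 4 + 1,
    { tree := SimpleGraph.pathGraph _
      isTree := pathGraph_isTree _
      bag := fun t => Finset.univ.filter
        fun v => (v : ℕ) = 0 ∨ (t : ℕ) + 1 ≤ v ∧ (v : ℕ) ≤ t + 3
      vertex_mem := fun v => by simpa using hvert v
      edge_mem := fun u v h => ?_
      connected := fun v => ?_ }, ?_⟩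
  · simp only [Finset.mem_filter, Finset.mem_univ, true_and]
    rcases lt_or_gt_of_ne h.ne with h' | h'
    · exact hedge u v h h'
    · obtain ⟨t, ht, ht'⟩ := hedge v u h.symm h'
      exact ⟨t, ht', ht⟩
  · refine pathGraph_induce_ordConnected ?_ ⟨?_⟩
    · obtain ⟨t, ht⟩ := hvert v
      exact ⟨t, by simpa using ht⟩
    · intro x hx y hy z hz
      simp only [Finset.mem_filter, Finset.mem_univ, true_and, Set.mem_ofPred_eq,
        Set.mem_Icc, Fin.le_def] at hx hy hz ⊢
      omega
  · intro t
    have ht := t.2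
    have : (Finset.univ.filter
        fun v : Fin n => (v : ℕ) = 0 ∨ (t : ℕ) + 1 ≤ v ∧ (v : ℕ) ≤ t + 3) ⊆
        {⟨0, by omega⟩, ⟨t + 1, by omega⟩, ⟨t + 2, by omega⟩, ⟨t + 3, by omega⟩} := by
      intro v hv
      simp only [Finset.mem_filter, Finset.mem_univ, true_and, Finset.mem_insert,
        Finset.mem_singleton, Fin.ext_iff] at hv ⊢
      omega
    exact (Finset.card_le_card this).trans Finset.card_le_four

end TreewidthBounds

/-! ### Prolonging segments beyond relative interior points. -/

section RelativeInterior

theorem exists_extension_of_mem_intrinsicInterior {E : Type*} [AddCommGroup E] [Module ℝ E]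
    [TopologicalSpace E] [ContinuousAdd E] [ContinuousSMul ℝ E] {s : Set E} {x y : E}
    (hx : x ∈ intrinsicInterior ℝ s) (hy : y ∈ s) : ∃ ε : ℝ, 0 < ε ∧ x + ε • (x - y) ∈ s := by
  rw [mem_intrinsicInterior] at hx
  obtain ⟨x', hx', rfl⟩ := hx
  have hmem : ∀ t : ℝ, (x' : E) + t • ((x' : E) - y) ∈ affineSpan ℝ s := by
    intro t
    have := AffineMap.lineMap_mem (-t) x'.2 (subset_affineSpan ℝ s hy)
    rw [AffineMap.lineMap_apply] at this
    convert this using 1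
    simp only [vsub_eq_sub, vadd_eq_add, neg_smul, smul_sub]
    abel
  let f : ℝ → affineSpan ℝ s := fun t => ⟨_, hmem t⟩
  have hf : Continuous f := Continuous.subtype_mk (by fun_prop) _
  have hf0 : f 0 = x' := Subtype.ext (by simp [f])
  have hnhds : f ⁻¹' ((↑) ⁻¹' s) ∈ nhds (0 : ℝ) := by
    apply hf.continuousAt
    rw [hf0]
    exact mem_interior_iff_mem_nhds.1 hx'
  obtain ⟨ε, hε, hball⟩ := Metric.mem_nhds_iff.1 hnhds
  refine ⟨ε / 2, by positivity, ?_⟩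
  have : ε / 2 ∈ Metric.ball (0 : ℝ) ε := by
    rw [Metric.mem_ball, Real.dist_eq, sub_zero, abs_of_pos (by positivity)]
    linarith
  exact hball this

end RelativeInterior

/-! ### Passing between stress vectors and sparse symmetric matrices. -/

section Stress

variable {V : Type*} (G : SimpleGraph V)

theorem stressMatrix_isSymm (ω : V ⊕ G.edgeSet → ℝ) : (stressMatrix G ω).IsSymm := by
  ext i j
  simp only [transpose_apply, stressMatrix, of_apply]
  by_cases hij : i = j
  · subst hij; rfl
  · rw [if_neg hij, if_neg (Ne.symm hij)]
    by_cases h : G.Adj i j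
    · rw [dif_pos h, dif_pos h.symm]
      congr 4
      exact Sym2.eq_swap
    · rw [dif_neg h, dif_neg fun h' => h h'.symm]

theorem stressMatrix_eq_zero (ω : V ⊕ G.edgeSet → ℝ) {i j : V} (hij : i ≠ j) (h : ¬ G.Adj i j) :
    stressMatrix G ω i j = 0 := by
  simp [stressMatrix, hij, h]

/-- The entries of a symmetric matrix on the edges of a graph. -/
noncomputable def edgeEntries (M : Matrix V V ℝ) (hM : M.IsSymm) (e : G.edgeSet) : ℝ :=
  Sym2.lift ⟨fun i j => M i j, fun i j => hM.apply j i⟩ e.1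

/-- The vector `ω` with prescribed matrix `Ω`. -/
noncomputable def stressOf (M : Matrix V V ℝ) (hM : M.IsSymm) : V ⊕ G.edgeSet → ℝ :=
  Sum.elim (fun i => M i i) (fun e => 2 * edgeEntries G M hM e)

theorem stressMatrix_stressOf (M : Matrix V V ℝ) (hM : M.IsSymm)
    (h0 : ∀ i j, i ≠ j → ¬ G.Adj i j → M i j = 0) :
    stressMatrix G (stressOf G M hM) = M := by
  ext i j
  simp only [stressMatrix, of_apply, stressOf, Sum.elim_inl, Sum.elim_inr, edgeEntries]
  split_ifs with h1 h2
  · rw [h1]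
  · simp
  · exact (h0 i j h1 h2).symm

end Stress

variable {V : Type*} [Fintype V]

/-! ### Isotropic vectors and null sets of nested sequences. -/

section QuadraticForms

theorem dotProduct_mulVec_symm {M : Matrix V V ℝ} (hM : M.IsSymm) (x y : V → ℝ) :
    x ⬝ᵥ (M *ᵥ y) = y ⬝ᵥ (M *ᵥ x) := by
  rw [dotProduct_mulVec, dotProduct_comm, ← mulVec_transpose, hM.eq]

theorem dotProduct_mulVec_add_smul {M : Matrix V V ℝ} (hM : M.IsSymm) (x y : V → ℝ) (t : ℝ) :
    (x + t • y) ⬝ᵥ (M *ᵥ (x + t • y)) =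
      x ⬝ᵥ (M *ᵥ x) + 2 * t * (x ⬝ᵥ (M *ᵥ y)) + t ^ 2 * (y ⬝ᵥ (M *ᵥ y)) := by
  have := dotProduct_mulVec_symm hM y x
  simp only [mulVec_add, mulVec_smul, dotProduct_add, add_dotProduct, smul_dotProduct,
    dotProduct_smul, smul_eq_mul, this]
  ring

/-- If a quadratic form is nonnegative on a subspace, then its isotropic vectors in the subspace
are orthogonal to the subspace. -/
theorem dotProduct_mulVec_eq_zero_of_nonneg {M : Matrix V V ℝ} (hM : M.IsSymm)
    {W : Submodule ℝ (V → ℝ)} (hW : ∀ x ∈ W, 0 ≤ x ⬝ᵥ (M *ᵥ x)) {v w : V → ℝ} (hv : v ∈ W)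
    (hv0 : v ⬝ᵥ (M *ᵥ v) = 0) (hw : w ∈ W) : w ⬝ᵥ (M *ᵥ v) = 0 := by
  by_contra hB
  set B := w ⬝ᵥ (M *ᵥ v) with hBdef
  set q := w ⬝ᵥ (M *ᵥ w) with hq
  -- The multiple of `v` is chosen so that the form at `w + t v`, namely `q + 2tB`, equals -1.
  have h := hW _ (W.add_mem hw (W.smul_mem (-(q + 1) / (2 * B)) hv))
  rw [dotProduct_mulVec_add_smul hM, hv0, ← hBdef, ← hq] at h
  have : 2 * (-(q + 1) / (2 * B)) * B = -(q + 1) := by field_simp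
  rw [this] at h
  linarith

variable {k : ℕ} {Y : Fin k → Matrix V V ℝ}

theorem nullSet_zero : nullSet Y 0 = Set.univ := by
  ext x; simp [nullSet]

theorem mem_nullSet_succ {j : ℕ} (hj : j < k) {x : V → ℝ} :
    x ∈ nullSet Y (j + 1) ↔ x ∈ nullSet Y j ∧ x ⬝ᵥ (Y ⟨j, hj⟩ *ᵥ x) = 0 := by
  constructor
  · exact fun h => ⟨fun i hi => h i (by omega), h ⟨j, hj⟩ (by simp)⟩
  · rintro ⟨h, h'⟩ i hi
    rcases Nat.lt_succ_iff_lt_or_eq.1 hi with hlt | heq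
    · exact h i hlt
    · obtain rfl : i = ⟨j, hj⟩ := Fin.ext heq
      exact h'

/-- On the previous subspace the form is nonnegative, so cross terms of isotropic vectors vanish and
sums stay isotropic. -/
theorem exists_submodule_nullSet (hY : ∀ i, (Y i).IsSymm) (hn : IsNestedPSD Y) (j : ℕ)
    (hj : j ≤ k) : ∃ W : Submodule ℝ (V → ℝ), (W : Set (V → ℝ)) = nullSet Y j := by
  induction j with
  | zero => exact ⟨⊤, by simp [nullSet_zero]⟩
  | succ j ih =>
    obtain ⟨W, hW⟩ := ih (by omega)
    have hjk : j < k := hj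
    have hmem : ∀ x, x ∈ W ↔ x ∈ nullSet Y j := fun x => by rw [← hW]; rfl
    have hpsd : ∀ x ∈ W, 0 ≤ x ⬝ᵥ (Y ⟨j, hjk⟩ *ᵥ x) := fun x hx =>
      hn ⟨j, hjk⟩ x ((hmem x).1 hx)
    refine ⟨{ carrier := nullSet Y (j + 1), add_mem' := ?_, zero_mem' := ?_, smul_mem' := ?_ }, rfl⟩
    · intro a b ha hb
      rw [mem_nullSet_succ hjk, ← hmem] at ha hb ⊢
      refine ⟨W.add_mem ha.1 hb.1, ?_⟩
      have h := dotProduct_mulVec_add_smul (hY ⟨j, hjk⟩) a b 1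
      rw [one_smul] at h
      rw [h, ha.2, hb.2, dotProduct_mulVec_eq_zero_of_nonneg (hY _) hpsd hb.1 hb.2 ha.1]
      simp
    · intro i hi
      simp
    · intro t a ha
      rw [mem_nullSet_succ hjk, ← hmem] at ha ⊢
      refine ⟨W.smul_mem t ha.1, ?_⟩
      rw [mulVec_smul, dotProduct_smul, smul_dotProduct, ha.2]
      simp

/-- A step that does not shrink the null set can be omitted; later indices then shift by one. -/
theorem nullSet_comp_succAbove {k : ℕ} {Y : Fin (k + 1) → Matrix V V ℝ} (j : Fin (k + 1))
    (hj : nullSet Y j ⊆ nullSet Y (j + 1)) (m : ℕ) (hm : m ≤ k) :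
    nullSet (fun i => Y (j.succAbove i)) m = nullSet Y (if m < j then m else m + 1) := by
  ext x
  split_ifs with hmj
  · constructor
    · intro h i hi
      have := h ⟨i, by omega⟩ hi
      beta_reduce at this
      rwa [Fin.succAbove_of_castSucc_lt _ _ (by simp only [Fin.lt_def, Fin.val_castSucc]; omega)] at this
    · intro h i hi
      beta_reduce
      rw [Fin.succAbove_of_castSucc_lt _ _ (by simp only [Fin.lt_def, Fin.val_castSucc]; omega)]
      exact h _ (by simpa using hi)
  · constructor
    · intro h
      have h' : x ∈ nullSet Y j := by
        intro i hi
        have := h ⟨i, by omega⟩ (by simp only; omega)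
        beta_reduce at this
        rwa [Fin.succAbove_of_castSucc_lt _ _ (by simp only [Fin.lt_def, Fin.val_castSucc]; omega)] at this
      intro i hi
      rcases lt_trichotomy i j with hij | hij | hij
      · exact h' i hij
      · exact hj h' i (by omega)
      · rw [Fin.lt_def] at hij
        have := h ⟨i - 1, by omega⟩ (by simp only; omega)
        beta_reduce at this
        rw [Fin.succAbove_of_le_castSucc _ _ (by simp [Fin.le_def]; omega)] at this
        convert this using 4; apply Fin.ext; simp; omega
    · intro h i hi
      apply h
      rcases lt_or_ge i.castSucc j with hij | hij
      · rw [Fin.succAbove_of_castSucc_lt _ _ hij]; simp; omega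
      · rw [Fin.succAbove_of_le_castSucc _ _ hij]; simp; omega

end QuadraticForms

/-! ### Dual values, boundedness of the singularity degree, and the feasible set. -/

section StressSums

variable (G : SimpleGraph V)

theorem sum_edgeSet_eq (F : G.edgeSet → ℝ) :
    2 * ∑ e, F e = ∑ i, ∑ j, if h : G.Adj i j then F ⟨s(i, j), G.mem_edgeSet.2 h⟩ else 0 := by
  have h1 : ∀ i j : V, (if h : G.Adj i j then F ⟨s(i, j), G.mem_edgeSet.2 h⟩ else 0) =
      ∑ e : G.edgeSet, if e.1 = s(i, j) then F e else 0 := by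
    intro i j
    split_ifs with h
    · rw [Finset.sum_eq_single ⟨s(i, j), G.mem_edgeSet.2 h⟩]
      · simp
      · intro e _ he
        rw [if_neg fun h' => he (Subtype.ext h')]
      · simp
    · refine (Finset.sum_eq_zero fun e _ => ?_).symm
      rw [if_neg]
      intro h'
      exact h (G.mem_edgeSet.1 (h' ▸ e.2))
  have h2 : ∀ e : G.edgeSet, ∑ i, ∑ j, (if e.1 = s(i, j) then F e else 0) = 2 * F e := by
    rintro ⟨e, he⟩
    induction e with
    | _ a b =>
      have hab : a ≠ b := (G.mem_edgeSet.1 he).ne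
      have : ∀ i j, (if s(a, b) = s(i, j) then F ⟨s(a, b), he⟩ else 0) =
          (if i = a then if j = b then F ⟨s(a, b), he⟩ else 0 else 0) +
          (if i = b then if j = a then F ⟨s(a, b), he⟩ else 0 else 0) := by
        intro i j
        simp only [Sym2.eq_iff]
        grind
      simp only [this, Finset.sum_add_distrib]
      simp
      ring
  simp_rw [h1]
  rw [Finset.mul_sum]
  conv_rhs => enter [2, i]; rw [Finset.sum_comm]
  rw [Finset.sum_comm]
  exact Finset.sum_congr rfl fun e _ => (h2 e).symm

variable {G}

/-- The dual value of `ω` is the inner product of `Ω` with any feasible matrix. -/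
theorem dualValue_eq {c : G.edgeSet → ℝ} {X : Matrix V V ℝ} (hX : X ∈ feasibleSet G c)
    (ω : V ⊕ G.edgeSet → ℝ) : dualValue G c ω = ∑ i, ∑ j, stressMatrix G ω i j * X i j := by
  have h : ∑ e : G.edgeSet, ω (Sum.inr e) * c e = ∑ i, ∑ j,
      (if h : G.Adj i j then ω (Sum.inr ⟨s(i, j), G.mem_edgeSet.2 h⟩) / 2 *
        c ⟨s(i, j), G.mem_edgeSet.2 h⟩ else 0) := by
    rw [← sum_edgeSet_eq G fun e => ω (Sum.inr e) / 2 * c e, Finset.mul_sum]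
    exact Finset.sum_congr rfl fun e _ => by ring
  have h' : ∑ i, ω (Sum.inl i) = ∑ i, ∑ j, if i = j then ω (Sum.inl i) else 0 := by simp
  rw [dualValue, h, h', ← Finset.sum_add_distrib]
  refine Finset.sum_congr rfl fun i _ => ?_
  rw [← Finset.sum_add_distrib]
  refine Finset.sum_congr rfl fun j _ => ?_
  simp only [stressMatrix, of_apply]
  by_cases hij : i = j
  · subst hij
    simp [hX.1.2]
  · by_cases hadj : G.Adj i j
    · simp [hij, hadj, hX.2 i j hadj]
    · simp [hij, hadj]

/-- In a shortest sequence every step strictly lowers the dimension of the null space, as an idle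
one could be deleted. If no sequence exists, the infimum is 0. -/
theorem sdWeight_le_card (c : G.edgeSet → ℝ) : sdWeight G c ≤ Fintype.card V := by
  by_contra! hlt
  have hne : {k : ℕ | ∃ ω : Fin k → V ⊕ G.edgeSet → ℝ, IsFacialReduction G c ω}.Nonempty := by
    by_contra h
    rw [Set.not_nonempty_iff_eq_empty] at h
    simp [sdWeight, h] at hlt
  have hmem := Nat.sInf_mem hne
  have hmin : ∀ m < sdWeight G c, ¬ ∃ ω : Fin m → V ⊕ G.edgeSet → ℝ, IsFacialReduction G c ω :=
    fun m hm => Nat.notMem_of_lt_sInf hm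
  change ∃ ω : Fin (sdWeight G c) → V ⊕ G.edgeSet → ℝ, IsFacialReduction G c ω at hmem
  generalize sdWeight G c = K at hlt hmem hmin
  obtain ⟨k, rfl⟩ : ∃ k, K = k + 1 := ⟨K - 1, by omega⟩
  obtain ⟨ω, hω⟩ := hmem
  set Y : Fin (k + 1) → Matrix V V ℝ := fun j => stressMatrix G (ω j) with hY
  have hsub : ∀ j, ∃ W : Submodule ℝ (V → ℝ), j ≤ k + 1 → (W : Set (V → ℝ)) = nullSet Y j := by
    intro j
    by_cases hj : j ≤ k + 1
    · obtain ⟨W, hW⟩ := exists_submodule_nullSet (fun i => stressMatrix_isSymm G _) hω.nested j hj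
      exact ⟨W, fun _ => hW⟩
    · exact ⟨⊤, fun h => absurd h hj⟩
  choose W hW using hsub
  have hex : ∃ j : Fin (k + 1), nullSet Y j ⊆ nullSet Y (j + 1) := by
    by_contra! hno
    have hrank : ∀ j ≤ k + 1, Module.finrank ℝ (W j) + j ≤ Fintype.card V := by
      intro j
      induction j with
      | zero =>
        intro _
        simpa using (W 0).finrank_le
      | succ j ih =>
        intro hj
        have hj' : j ≤ k + 1 := by omega
        have hlt : W (j + 1) < W j := by
          rw [← SetLike.coe_ssubset_coe, hW _ hj, hW _ hj', Set.ssubset_iff_subset_ne]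
          refine ⟨fun x hx => ((mem_nullSet_succ hj).1 hx).1, fun h => hno ⟨j, hj⟩ ?_⟩
          exact h.symm.subset
        have := Submodule.finrank_lt_finrank_of_lt hlt
        have := ih hj'
        omega
    have := hrank (k + 1) le_rfl
    omega
  obtain ⟨j, hj⟩ := hex
  refine hmin k (by omega) ⟨fun i => ω (j.succAbove i), ⟨?_, fun i => hω.dualValue_nonpos _, ?_⟩⟩
  · intro i x hx
    rw [nullSet_comp_succAbove (Y := Y) j hj i i.2.le] at hx
    refine hω.nested (j.succAbove i) x ?_
    convert hx using 2
    rcases lt_or_ge i.castSucc j with hij | hij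
    · rw [Fin.succAbove_of_castSucc_lt _ _ hij, if_pos (by simpa [Fin.lt_def] using hij)]; simp
    · rw [Fin.succAbove_of_le_castSucc _ _ hij, if_neg (by simpa [Fin.le_def] using hij)]; simp
  · obtain ⟨X, hX, hr⟩ := hω.rank_eq
    refine ⟨X, hX, ?_⟩
    rw [← hr, nullSet_comp_succAbove (Y := Y) j hj k le_rfl, if_neg (by omega)]

theorem sdWeight_le_sd {c : G.edgeSet → ℝ} (hc : c ∈ coordinateShadow G) :
    sdWeight G c ≤ sd G :=
  le_csSup ⟨Fintype.card V, by rintro _ ⟨c, -, rfl⟩; exact sdWeight_le_card c⟩ ⟨c, hc, rfl⟩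

theorem feasibleSet_convex (c : G.edgeSet → ℝ) : Convex ℝ (feasibleSet G c) := by
  intro X hX Y hY a b ha hb hab
  refine ⟨⟨(hX.1.1.smul ha).add (hY.1.1.smul hb), fun i => ?_⟩, fun i j h => ?_⟩
  · simp [hX.1.2, hY.1.2, hab]
  · simp only [Matrix.add_apply, Matrix.smul_apply, hX.2 i j h, hY.2 i j h, smul_eq_mul]
    rw [← add_mul, hab, one_mul]

theorem intrinsicInterior_feasibleSet_nonempty {c : G.edgeSet → ℝ}
    (hc : c ∈ coordinateShadow G) : (intrinsicInterior ℝ (feasibleSet G c)).Nonempty := by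
  let : NormedAddCommGroup (Matrix V V ℝ) := Matrix.normedAddCommGroup
  let : NormedSpace ℝ (Matrix V V ℝ) := Matrix.normedSpace
  exact Set.Nonempty.intrinsicInterior (feasibleSet_convex c) hc

/-- The kernel of a relative interior point is contained in that of every feasible matrix. -/
theorem dotProduct_mulVec_eq_zero_of_mem_intrinsicInterior {c : G.edgeSet → ℝ}
    {X X₀ : Matrix V V ℝ} (hX : X ∈ intrinsicInterior ℝ (feasibleSet G c))
    (hX₀ : X₀ ∈ feasibleSet G c) {x : V → ℝ} (hx : X *ᵥ x = 0) : x ⬝ᵥ (X₀ *ᵥ x) = 0 := by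
  -- At a kernel vector `x` of `X`, the feasible matrix `X + ε (X - X₀)` has value `-ε xᵀ X₀ x`, so
  -- `xᵀ X₀ x` cannot be positive.
  obtain ⟨ε, hε, h⟩ := exists_extension_of_mem_intrinsicInterior hX hX₀
  have h1 := h.1.1.dotProduct_mulVec_nonneg x
  have h2 := hX₀.1.1.dotProduct_mulVec_nonneg x
  simp only [star_trivial, add_mulVec, smul_mulVec, sub_mulVec, hx, dotProduct_smul,
    dotProduct_sub, dotProduct_add, dotProduct_zero, smul_eq_mul] at h1 h2
  nlinarith

end StressSums

/-! ### The chain graph, its configuration vectors and its spaces. -/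

section Chain

/-- The pairs `u < v` joined in the chain of `k` triangles: consecutive triples
`3i + 1, 3i + 2, 3i + 3` are triangles, `0` is joined to `3i + 1`, `3i` is joined to `3i + 2`, `0` is
joined to `3`, and `0` is joined to all vertices beyond `3k`. -/
def chainRel (k u v : ℕ) : Prop :=
  v ≤ 3 * k ∧ (u = 0 ∧ v % 3 = 1 ∨ u % 3 = 1 ∧ (v = u + 1 ∨ v = u + 2) ∨ u % 3 = 2 ∧ v = u + 1 ∨
    u % 3 = 0 ∧ v = u + 2 ∨ u = 0 ∧ v = 3) ∨ u = 0 ∧ 3 * k < v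

variable (k e : ℕ)

/-- The graph of a chain of `k` triangles with `e` pendant vertices. -/
def chainGraph : SimpleGraph (Fin (3 * k + 1 + e)) where
  Adj u v := chainRel k u v ∨ chainRel k v u
  symm := ⟨fun _ _ h => h.symm⟩
  loopless := ⟨fun u h => by unfold chainRel at h; omega⟩

variable {k e} in
theorem chainGraph_adj {u v : Fin (3 * k + 1 + e)} :
    (chainGraph k e).Adj u v ↔ chainRel k u v ∨ chainRel k v u := Iff.rfl

theorem treewidth_chainGraph (hk : 1 ≤ k) : treewidth (chainGraph k e) = 3 := by
  obtain ⟨m, D, hD⟩ := exists_treeDecomposition_of_band (by omega) (chainGraph k e)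
    (fun u v h huv => by
      rw [Fin.lt_def] at huv
      change chainRel k u v ∨ chainRel k v u at h
      unfold chainRel at h
      omega)
  apply le_antisymm
  · exact Nat.sInf_le ⟨m, D, hD⟩
  · have h4 : 4 ≤ 3 * k + 1 + e := by omega
    refine three_le_treewidth (Fin.castLE h4) (Fin.castLE_injective h4) (fun i j h => ?_)
      ⟨3, m, D, hD⟩
    rw [chainGraph_adj]
    simp only [Fin.val_castLE]
    have : (i : ℕ) ≠ j := fun h' => h (Fin.ext h')
    rcases lt_or_gt_of_ne this with h' | h'
    · exact Or.inl (Or.inl ⟨by omega, by omega⟩)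
    · exact Or.inr (Or.inl ⟨by omega, by omega⟩)

variable {k}

/-- The hub of the chain. -/
def hub : Fin (3 * k + 1 + e) := ⟨0, by omega⟩

/-- The first vertex of a triangle of the chain. -/
def vA (i : Fin k) : Fin (3 * k + 1 + e) := ⟨3 * i + 1, by omega⟩

/-- The second vertex of a triangle of the chain. -/
def vB (i : Fin k) : Fin (3 * k + 1 + e) := ⟨3 * i + 2, by omega⟩

/-- The last vertex of a triangle of the chain. -/
def vZ (i : Fin k) : Fin (3 * k + 1 + e) := ⟨3 * i + 3, by omega⟩

/-- The last vertex before a triangle of the chain. -/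
def vY (i : Fin k) : Fin (3 * k + 1 + e) := ⟨3 * i, by omega⟩

variable {e}

theorem vertex_cases (v : Fin (3 * k + 1 + e)) :
    v = hub e ∨ (∃ i, v = vA e i) ∨ (∃ i, v = vB e i) ∨ (∃ i, v = vZ e i) ∨ 3 * k < (v : ℕ) := by
  rcases Nat.lt_or_ge (3 * k) v with h | h
  · tauto
  rcases Nat.eq_zero_or_pos (v : ℕ) with h0 | h0
  · exact Or.inl (Fin.ext h0)
  have h3 : ((v : ℕ) - 1) / 3 < k := by omega
  have : (v : ℕ) % 3 = 1 ∨ (v : ℕ) % 3 = 2 ∨ (v : ℕ) % 3 = 0 := by omega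
  rcases this with h1 | h1 | h1
  · exact Or.inr (Or.inl ⟨⟨_, h3⟩, Fin.ext (by simp only [vA]; omega)⟩)
  · exact Or.inr (Or.inr (Or.inl ⟨⟨_, h3⟩, Fin.ext (by simp only [vB]; omega)⟩))
  · exact Or.inr (Or.inr (Or.inr (Or.inl ⟨⟨_, h3⟩, Fin.ext (by simp only [vZ]; omega)⟩)))

variable (k e)

/-- The component of the vector configuration shared by all triangles. -/
noncomputable def axisVec : Fin (3 * k + 1 + e) → ℝ :=
  fun v => if (v : ℕ) ≤ 3 * k ∧ (v : ℕ) % 3 ≠ 0 then -1 / 2 else 1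

variable {k}

/-- The component of the vector configuration private to a triangle. -/
noncomputable def spinVec (i : Fin k) : Fin (3 * k + 1 + e) → ℝ :=
  Pi.single (vA e i) 1 - Pi.single (vB e i) 1

/-- The direction in which the last vertex of a triangle may leave the axis. -/
noncomputable def flexVec (i : Fin k) : Fin (3 * k + 1 + e) → ℝ :=
  Pi.single (vZ e i) 1 - (1 / 2 : ℝ) • (Pi.single (vA e i) 1 + Pi.single (vB e i) 1)

variable {e}

section Values

variable (i j : Fin k)

@[simp] theorem axisVec_hub : axisVec k e (hub e) = 1 := by simp [axisVec, hub]

@[simp] theorem axisVec_vA : axisVec k e (vA e i) = -1 / 2 := by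
  rw [axisVec, if_pos (by simp only [vA]; omega)]

@[simp] theorem axisVec_vB : axisVec k e (vB e i) = -1 / 2 := by
  rw [axisVec, if_pos (by simp only [vB]; omega)]

@[simp] theorem axisVec_vZ : axisVec k e (vZ e i) = 1 := by
  rw [axisVec, if_neg (by simp only [vZ]; omega)]

@[simp] theorem axisVec_vY : axisVec k e (vY e i) = 1 := by
  rw [axisVec, if_neg (by simp only [vY]; omega)]

theorem axisVec_pendant {v : Fin (3 * k + 1 + e)} (hv : 3 * k < (v : ℕ)) : axisVec k e v = 1 := by
  rw [axisVec, if_neg (by omega)]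

theorem spinVec_apply (v : Fin (3 * k + 1 + e)) :
    spinVec e i v = if (v : ℕ) = 3 * i + 1 then 1 else if (v : ℕ) = 3 * i + 2 then -1 else 0 := by
  simp only [spinVec, Pi.sub_apply, Pi.single_apply, Fin.ext_iff, vA, vB]
  split_ifs <;> first | omega | norm_num

theorem flexVec_apply (v : Fin (3 * k + 1 + e)) :
    flexVec e i v = if (v : ℕ) = 3 * i + 3 then 1 else
      if (v : ℕ) = 3 * i + 1 ∨ (v : ℕ) = 3 * i + 2 then -1 / 2 else 0 := by
  simp only [flexVec, Pi.sub_apply, Pi.smul_apply, Pi.add_apply, Pi.single_apply, Fin.ext_iff, vA,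
    vB, vZ]
  split_ifs <;> first | omega | norm_num

@[simp] theorem spinVec_hub : spinVec e i (hub e) = 0 := by simp [spinVec_apply, hub]

@[simp] theorem spinVec_vA : spinVec e i (vA e j) = if j = i then 1 else 0 := by
  by_cases h : j = i
  · subst h
    simp [spinVec_apply, vA]
  · rw [Fin.ext_iff] at h
    rw [spinVec_apply, if_neg (by simp only [vA]; omega), if_neg (by simp only [vA]; omega),
      if_neg (by rwa [Fin.ext_iff])]

@[simp] theorem spinVec_vB : spinVec e i (vB e j) = if j = i then -1 else 0 := by
  by_cases h : j = i
  · subst h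
    simp [spinVec_apply, vB]
  · rw [Fin.ext_iff] at h
    rw [spinVec_apply, if_neg (by simp only [vB]; omega), if_neg (by simp only [vB]; omega),
      if_neg (by rwa [Fin.ext_iff])]

@[simp] theorem spinVec_vZ : spinVec e i (vZ e j) = 0 := by
  rw [spinVec_apply, if_neg (by simp only [vZ]; omega), if_neg (by simp only [vZ]; omega)]

@[simp] theorem spinVec_vY : spinVec e i (vY e j) = 0 := by
  rw [spinVec_apply, if_neg (by simp only [vY]; omega), if_neg (by simp only [vY]; omega)]

theorem spinVec_pendant {v : Fin (3 * k + 1 + e)} (hv : 3 * k < (v : ℕ)) : spinVec e i v = 0 := by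
  rw [spinVec_apply, if_neg (by omega), if_neg (by omega)]

@[simp] theorem flexVec_hub : flexVec e i (hub e) = 0 := by simp [flexVec_apply, hub]

@[simp] theorem flexVec_vA : flexVec e i (vA e j) = if j = i then -1 / 2 else 0 := by
  by_cases h : j = i
  · subst h
    simp [flexVec_apply, vA]
  · rw [Fin.ext_iff] at h
    rw [flexVec_apply, if_neg (by simp only [vA]; omega), if_neg (by simp only [vA]; omega),
      if_neg (by rwa [Fin.ext_iff])]

@[simp] theorem flexVec_vB : flexVec e i (vB e j) = if j = i then -1 / 2 else 0 := by
  by_cases h : j = i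
  · subst h
    simp [flexVec_apply, vB]
  · rw [Fin.ext_iff] at h
    rw [flexVec_apply, if_neg (by simp only [vB]; omega), if_neg (by simp only [vB]; omega),
      if_neg (by rwa [Fin.ext_iff])]

@[simp] theorem flexVec_vZ : flexVec e i (vZ e j) = if j = i then 1 else 0 := by
  by_cases h : j = i
  · subst h
    simp [flexVec_apply, vZ]
  · rw [Fin.ext_iff] at h
    rw [flexVec_apply, if_neg (by simp only [vZ]; omega), if_neg (by simp only [vZ]; omega),
      if_neg (by rwa [Fin.ext_iff])]

theorem flexVec_pendant {v : Fin (3 * k + 1 + e)} (hv : 3 * k < (v : ℕ)) : flexVec e i v = 0 := by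
  rw [flexVec_apply, if_neg (by omega), if_neg (by omega)]

theorem spinVec_dotProduct (y : Fin (3 * k + 1 + e) → ℝ) :
    spinVec e i ⬝ᵥ y = y (vA e i) - y (vB e i) := by
  simp [spinVec, sub_dotProduct]

theorem flexVec_dotProduct (y : Fin (3 * k + 1 + e) → ℝ) :
    flexVec e i ⬝ᵥ y = y (vZ e i) - (y (vA e i) + y (vB e i)) / 2 := by
  simp [flexVec, sub_dotProduct, add_dotProduct]
  ring

end Values

variable (k e)

/-- The vectors satisfying the relations of all triangles, those of the pendant vertices, and the
coincidence of the last vertices of the first `j` triangles with the hub. -/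
def chainSpace (j : ℕ) : Submodule ℝ (Fin (3 * k + 1 + e) → ℝ) where
  carrier := {x | (∀ i : Fin k, x (vA e i) + x (vB e i) + x (vZ e i) = 0) ∧
    (∀ i : Fin k, (i : ℕ) < j → x (vZ e i) = x (hub e)) ∧
    ∀ v : Fin (3 * k + 1 + e), 3 * k < (v : ℕ) → x v = x (hub e)}
  add_mem' := by
    rintro x y ⟨h1, h2, h3⟩ ⟨h1', h2', h3'⟩
    refine ⟨fun i => ?_, fun i hi => ?_, fun v hv => ?_⟩
    · simp only [Pi.add_apply]
      linear_combination h1 i + h1' i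
    · simp only [Pi.add_apply, h2 i hi, h2' i hi]
    · simp only [Pi.add_apply, h3 v hv, h3' v hv]
  zero_mem' := by simp
  smul_mem' := by
    rintro t x ⟨h1, h2, h3⟩
    refine ⟨fun i => ?_, fun i hi => ?_, fun v hv => ?_⟩
    · simp only [Pi.smul_apply, smul_eq_mul]
      linear_combination t * h1 i
    · simp only [Pi.smul_apply, h2 i hi]
    · simp only [Pi.smul_apply, h3 v hv]

variable {k e}

theorem mem_chainSpace {j : ℕ} {x : Fin (3 * k + 1 + e) → ℝ} :
    x ∈ chainSpace k e j ↔ (∀ i : Fin k, x (vA e i) + x (vB e i) + x (vZ e i) = 0) ∧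
    (∀ i : Fin k, (i : ℕ) < j → x (vZ e i) = x (hub e)) ∧
    ∀ v : Fin (3 * k + 1 + e), 3 * k < (v : ℕ) → x v = x (hub e) := Iff.rfl

theorem chainSpace_anti {i j : ℕ} (h : i ≤ j) : chainSpace k e j ≤ chainSpace k e i :=
  fun _ hx => ⟨hx.1, fun l hl => hx.2.1 l (hl.trans_le h), hx.2.2⟩

theorem axisVec_mem (j : ℕ) : axisVec k e ∈ chainSpace k e j :=
  ⟨fun i => by simp only [axisVec_vA, axisVec_vB, axisVec_vZ]; norm_num, fun i _ => by simp,
    fun v hv => by simp [axisVec_pendant hv]⟩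

theorem spinVec_mem (i : Fin k) (j : ℕ) : spinVec e i ∈ chainSpace k e j :=
  ⟨fun l => by by_cases h : l = i <;> simp [h], fun l _ => by simp,
    fun v hv => by simp [spinVec_pendant i hv]⟩

theorem flexVec_mem {i : Fin k} {j : ℕ} (hij : j ≤ i) : flexVec e i ∈ chainSpace k e j :=
  ⟨fun l => by by_cases h : l = i <;> simp [h],
    fun l hl => by rw [flexVec_vZ, if_neg (by rintro rfl; omega), flexVec_hub],
    fun v hv => by simp [flexVec_pendant i hv]⟩

theorem flexVec_notMem (i : Fin k) : flexVec e i ∉ chainSpace k e k := by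
  intro h
  have := h.2.1 i i.2
  simp at this

/-- Coordinates on `chainSpace`. -/
theorem eq_sum_of_mem_chainSpace {x : Fin (3 * k + 1 + e) → ℝ} {j : ℕ} (hx : x ∈ chainSpace k e j) :
    x = (x (hub e) • axisVec k e + ∑ i, ((x (vA e i) - x (vB e i)) / 2) • spinVec e i) +
      ∑ i, (x (vZ e i) - x (hub e)) • flexVec e i := by
  funext v
  simp only [Pi.add_apply, Pi.smul_apply, Finset.sum_apply, smul_eq_mul]
  rcases vertex_cases v with rfl | ⟨i, rfl⟩ | ⟨i, rfl⟩ | ⟨i, rfl⟩ | hv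
  · simp
  · have := hx.1 i
    simp
    linarith
  · have := hx.1 i
    simp
    linarith
  · simp
  · simp [axisVec_pendant hv, spinVec_pendant _ hv, flexVec_pendant _ hv, hx.2.2 v hv]

/-! ### Sparsity of the rows of a stress matrix on the chain. -/

section LowerBound

variable {M : Matrix (Fin (3 * k + 1 + e)) (Fin (3 * k + 1 + e)) ℝ}

theorem mulVec_vA (hM : ∀ u v, u ≠ v → ¬ (chainGraph k e).Adj u v → M u v = 0) (i : Fin k)
    (y : Fin (3 * k + 1 + e) → ℝ) :
    (M *ᵥ y) (vA e i) = M (vA e i) (vA e i) * y (vA e i) + M (vA e i) (vB e i) * y (vB e i) +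
      M (vA e i) (vZ e i) * y (vZ e i) + M (vA e i) (hub e) * y (hub e) := by
  rw [mulVec, dotProduct, ← Finset.sum_subset (Finset.subset_univ {vA e i, vB e i, vZ e i, hub e})]
  · rw [Finset.sum_insert, Finset.sum_insert, Finset.sum_insert, Finset.sum_singleton]
    · ring
    all_goals simp [Fin.ext_iff, vA, vB, vZ, hub]
  · intro v _ hv
    rw [hM, zero_mul]
    · rintro rfl; simp at hv
    · intro h
      change chainRel k (3 * i + 1) v ∨ chainRel k v (3 * i + 1) at h
      simp only [Finset.mem_insert, Finset.mem_singleton, Fin.ext_iff, vA, vB, vZ, hub] at hv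
      unfold chainRel at h
      omega

theorem mulVec_vB (hM : ∀ u v, u ≠ v → ¬ (chainGraph k e).Adj u v → M u v = 0) (i : Fin k)
    (y : Fin (3 * k + 1 + e) → ℝ) :
    (M *ᵥ y) (vB e i) = M (vB e i) (vA e i) * y (vA e i) + M (vB e i) (vB e i) * y (vB e i) +
      M (vB e i) (vZ e i) * y (vZ e i) + M (vB e i) (vY e i) * y (vY e i) := by
  rw [mulVec, dotProduct, ← Finset.sum_subset (Finset.subset_univ {vA e i, vB e i, vZ e i, vY e i})]
  · rw [Finset.sum_insert, Finset.sum_insert, Finset.sum_insert, Finset.sum_singleton]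
    · ring
    all_goals simp [Fin.ext_iff, vA, vB, vZ, vY]
  · intro v _ hv
    rw [hM, zero_mul]
    · rintro rfl; simp at hv
    · intro h
      change chainRel k (3 * i + 2) v ∨ chainRel k v (3 * i + 2) at h
      simp only [Finset.mem_insert, Finset.mem_singleton, Fin.ext_iff, vA, vB, vZ, vY] at hv
      unfold chainRel at h
      omega

/-- The sum has at most one term, from the second vertex of the next triangle; it is empty at the
end of the chain. -/
theorem mulVec_vZ (hM : ∀ u v, u ≠ v → ¬ (chainGraph k e).Adj u v → M u v = 0) (i : Fin k)
    (y : Fin (3 * k + 1 + e) → ℝ) :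
    (M *ᵥ y) (vZ e i) = M (vZ e i) (vA e i) * y (vA e i) + M (vZ e i) (vB e i) * y (vB e i) +
      M (vZ e i) (vZ e i) * y (vZ e i) + M (vZ e i) (hub e) * y (hub e) +
      ∑ l : Fin k, if (l : ℕ) = i + 1 then M (vZ e i) (vB e l) * y (vB e l) else 0 := by
  rw [← Finset.sum_filter, mulVec, dotProduct,
    ← Finset.sum_subset (Finset.subset_univ ({vA e i, vB e i, vZ e i, hub e} ∪
      (Finset.univ.filter fun l : Fin k => (l : ℕ) = i + 1).image (vB e)))]
  · rw [Finset.sum_union, Finset.sum_insert, Finset.sum_insert, Finset.sum_insert,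
      Finset.sum_singleton, Finset.sum_image]
    · ring
    · intro a _ b _ hab
      simp only [Fin.ext_iff, vB] at hab ⊢
      omega
    · simp [Fin.ext_iff, vZ, hub]
    · simp [Fin.ext_iff, vB, vZ, hub]
    · simp [Fin.ext_iff, vA, vB, vZ, hub]
    · rw [Finset.disjoint_left]
      intro v hv hv'
      simp only [Finset.mem_insert, Finset.mem_singleton, Finset.mem_image, Finset.mem_filter,
        Finset.mem_univ, true_and, Fin.ext_iff, vA, vB, vZ, hub] at hv hv'
      obtain ⟨l, hl, hl'⟩ := hv'
      omega
  · intro v _ hv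
    rw [hM, zero_mul]
    · rintro rfl; simp at hv
    · intro h
      change chainRel k (3 * i + 3) v ∨ chainRel k v (3 * i + 3) at h
      simp only [Finset.mem_insert, Finset.mem_singleton, Finset.mem_union, Finset.mem_image,
        Finset.mem_filter, Finset.mem_univ, true_and, not_or, not_exists, not_and, Fin.ext_iff, vA,
        vB, vZ, hub] at hv
      obtain ⟨hv1, hv2⟩ := hv
      unfold chainRel at h
      by_cases h5 : (v : ℕ) = 3 * i + 5
      · by_cases h6 : (i : ℕ) + 1 < k
        · exact hv2 ⟨i + 1, h6⟩ rfl (by simp only; omega)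
        · omega
      · omega

end LowerBound

end Chain

/-! ### At most one further coincidence per reduction step. -/

section ChainLowerBound

variable {k e : ℕ}

variable (k e) in
/-- The Gram matrix of the chain configuration: all triangles have pairwise angles of 120 degrees,
their planes meet in a common axis and are orthogonal apart from that. -/
noncomputable def chainGram : Matrix (Fin (3 * k + 1 + e)) (Fin (3 * k + 1 + e)) ℝ :=
  vecMulVec (axisVec k e) (axisVec k e) +
    ∑ i : Fin k, (3 / 4 : ℝ) • vecMulVec (spinVec e i) (spinVec e i)

theorem chainGram_apply (u v : Fin (3 * k + 1 + e)) : chainGram k e u v =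
    axisVec k e u * axisVec k e v + 3 / 4 * ∑ i : Fin k, spinVec e i u * spinVec e i v := by
  simp [chainGram, Matrix.add_apply, Matrix.sum_apply, vecMulVec_apply, Finset.mul_sum]

theorem sum_mul_mul_eq_dotProduct_mulVec {V : Type*} [Fintype V] (M : Matrix V V ℝ) (r : V → ℝ) :
    ∑ u, ∑ v, M u v * (r u * r v) = r ⬝ᵥ (M *ᵥ r) := by
  simp only [dotProduct, mulVec, Finset.mul_sum]
  exact Finset.sum_congr rfl fun u _ => Finset.sum_congr rfl fun v _ => by ring

theorem sum_mul_chainGram (M : Matrix (Fin (3 * k + 1 + e)) (Fin (3 * k + 1 + e)) ℝ) :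
    ∑ u, ∑ v, M u v * chainGram k e u v = axisVec k e ⬝ᵥ (M *ᵥ axisVec k e) +
      3 / 4 * ∑ i : Fin k, spinVec e i ⬝ᵥ (M *ᵥ spinVec e i) := by
  simp_rw [← sum_mul_mul_eq_dotProduct_mulVec, chainGram_apply, mul_add, Finset.sum_add_distrib]
  congr 1
  simp_rw [Finset.mul_sum]
  conv_rhs => rw [Finset.sum_comm]
  refine Finset.sum_congr rfl fun u _ => ?_
  conv_rhs => rw [Finset.sum_comm]
  refine Finset.sum_congr rfl fun v _ => Finset.sum_congr rfl fun i _ => by ring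

/-- One facial reduction step frees at most one further triangle of the chain. -/
theorem dotProduct_mulVec_eq_zero_of_step
    {M : Matrix (Fin (3 * k + 1 + e)) (Fin (3 * k + 1 + e)) ℝ} (hs : M.IsSymm)
    (hM : ∀ u v, u ≠ v → ¬ (chainGraph k e).Adj u v → M u v = 0)
    {W : Submodule ℝ (Fin (3 * k + 1 + e) → ℝ)} (hpos : ∀ x ∈ W, 0 ≤ x ⬝ᵥ (M *ᵥ x)) {j : ℕ}
    (hW : chainSpace k e j ≤ W) (hval : ∑ u, ∑ v, M u v * chainGram k e u v ≤ 0)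
    {x : Fin (3 * k + 1 + e) → ℝ} (hx : x ∈ chainSpace k e (j + 1)) : x ⬝ᵥ (M *ᵥ x) = 0 := by
  have hh : axisVec k e ∈ W := hW (axisVec_mem j)
  have hg : ∀ i, spinVec e i ∈ W := fun i => hW (spinVec_mem i j)
  have hf : ∀ i : Fin k, j ≤ i → flexVec e i ∈ W := fun i hi => hW (flexVec_mem hi)
  have hS : ∀ i : Fin k, 0 ≤ spinVec e i ⬝ᵥ (M *ᵥ spinVec e i) := fun i => hpos _ (hg i)
  rw [sum_mul_chainGram] at hval
  have hsum := Finset.sum_nonneg fun i (_ : i ∈ Finset.univ) => hS i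
  -- The dual value is a positive combination of the form at the axis and spin vectors, all
  -- nonnegative because these vectors lie in `W`.
  have hh0 : axisVec k e ⬝ᵥ (M *ᵥ axisVec k e) = 0 := by
    have := hpos _ hh
    linarith
  have hg0 : ∀ i : Fin k, spinVec e i ⬝ᵥ (M *ᵥ spinVec e i) = 0 := by
    have : ∑ i : Fin k, spinVec e i ⬝ᵥ (M *ᵥ spinVec e i) = 0 := by linarith
    exact fun i => (Finset.sum_eq_zero_iff_of_nonneg fun i _ => hS i).1 this i (Finset.mem_univ i)
  have hBh : ∀ w ∈ W, w ⬝ᵥ (M *ᵥ axisVec k e) = 0 := fun w hw =>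
    dotProduct_mulVec_eq_zero_of_nonneg hs hpos hh hh0 hw
  have hBg : ∀ i, ∀ w ∈ W, w ⬝ᵥ (M *ᵥ spinVec e i) = 0 := fun i w hw =>
    dotProduct_mulVec_eq_zero_of_nonneg hs hpos (hg i) (hg0 i) hw
  -- Pairing `flexVec e i` with the spin of the next triangle leaves only this entry, up to sign.
  have hnext : ∀ i l : Fin k, j ≤ i → (l : ℕ) = i + 1 → M (vZ e i) (vB e l) = 0 := by
    intro i l hi hl
    have h := hBg l _ (hf i hi)
    have hil : i ≠ l := by rintro rfl; omega
    rw [flexVec_dotProduct, mulVec_vZ hM, mulVec_vA hM, mulVec_vB hM, Finset.sum_eq_single l] at h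
    · simpa [hl, hil] using h
    · intro l' _ hl'
      rw [if_neg fun h' => hl' (Fin.ext (h'.trans hl.symm))]
    · simp
  have hrowZ : ∀ i : Fin k, j < i → ∀ y, (M *ᵥ y) (vZ e i) = M (vZ e i) (vA e i) * y (vA e i) +
      M (vZ e i) (vB e i) * y (vB e i) + M (vZ e i) (vZ e i) * y (vZ e i) := by
    intro i hi y
    rw [mulVec_vZ hM, hM (vZ e i) (hub e), Finset.sum_eq_zero]
    · ring
    · intro l _
      split_ifs with hl
      · rw [hnext i l hi.le hl, zero_mul]
      · rfl
    · simp [Fin.ext_iff, vZ, hub]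
    · rw [chainGraph_adj]
      simp only [vZ, hub, chainRel]
      omega
  have hrowB : ∀ i : Fin k, j < i → ∀ y, (M *ᵥ y) (vB e i) = M (vB e i) (vA e i) * y (vA e i) +
      M (vB e i) (vB e i) * y (vB e i) + M (vB e i) (vZ e i) * y (vZ e i) := by
    intro i hi y
    have hlt : (i : ℕ) - 1 < k := by omega
    have h1 : vY e i = vZ e ⟨(i : ℕ) - 1, hlt⟩ := Fin.ext (by simp only [vY, vZ]; omega)
    rw [mulVec_vB hM, ← hs.apply (vB e i) (vY e i), h1, hnext ⟨(i : ℕ) - 1, hlt⟩ i]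
    · ring
    · simp only; omega
    · simp only; omega
  -- On triangle `i` the axis and flex vectors agree. Hence `e2` and `e3` differ by the entry
  -- joining `vA e i` to the hub, which must vanish; then `e4` is the claim.
  have hflex : ∀ i : Fin k, j < i → flexVec e i ⬝ᵥ (M *ᵥ flexVec e i) = 0 := by
    intro i hi
    have e1 := hBg i _ (hg i)
    have e2 := hBh _ (hg i)
    have e3 := hBg i _ (hf i hi.le)
    have e4 := hBh _ (hf i hi.le)
    rw [spinVec_dotProduct, mulVec_vA hM, hrowB i hi] at e1 e2
    rw [flexVec_dotProduct, hrowZ i hi, mulVec_vA hM, hrowB i hi] at e3 e4 ⊢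
    rw [hs.apply (vA e i) (vB e i), hs.apply (vA e i) (vZ e i), hs.apply (vB e i) (vZ e i)] at *
    simp at e1 e2 e3 e4 ⊢
    linarith
  -- Different triangles beyond `j` are decoupled: the rows of triangle `i` reach only that triangle
  -- and the hub, where the other flex vectors vanish.
  have hcross : ∀ i l : Fin k, j < i → j < l → flexVec e i ⬝ᵥ (M *ᵥ flexVec e l) = 0 := by
    intro i l hi hl
    by_cases hil : i = l
    · subst hil; exact hflex i hi
    · rw [flexVec_dotProduct, hrowZ i hi, mulVec_vA hM, hrowB i hi]
      simp [hil]
  rw [eq_sum_of_mem_chainSpace hx]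
  set w := x (hub e) • axisVec k e + ∑ i, ((x (vA e i) - x (vB e i)) / 2) • spinVec e i with hw
  set f := ∑ i, (x (vZ e i) - x (hub e)) • flexVec e i with hfdef
  have hcoef : ∀ i : Fin k, ¬ j < i → x (vZ e i) - x (hub e) = 0 := fun i hi => by
    rw [hx.2.1 i (by omega), sub_self]
  have hfW : f ∈ W := by
    refine W.sum_mem fun i _ => ?_
    by_cases hi : j < i
    · exact W.smul_mem _ (hf i hi.le)
    · rw [hcoef i hi, zero_smul]
      exact W.zero_mem
  have hwW : w ∈ W := W.add_mem (W.smul_mem _ hh) (W.sum_mem fun i _ => W.smul_mem _ (hg i))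
  have hBw : ∀ y ∈ W, y ⬝ᵥ (M *ᵥ w) = 0 := by
    intro y hy
    rw [hw, mulVec_add, mulVec_smul, mulVec_sum, dotProduct_add, dotProduct_smul, hBh y hy,
      dotProduct_sum, Finset.sum_eq_zero]
    · simp
    · intro i _
      rw [mulVec_smul, dotProduct_smul, hBg i y hy, smul_zero]
  have hff : f ⬝ᵥ (M *ᵥ f) = 0 := by
    rw [hfdef, mulVec_sum, dotProduct_sum]
    refine Finset.sum_eq_zero fun l _ => ?_
    rw [sum_dotProduct]
    refine Finset.sum_eq_zero fun i _ => ?_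
    rw [mulVec_smul, dotProduct_smul, smul_dotProduct]
    by_cases hi : j < i
    · by_cases hl : j < l
      · rw [hcross i l hi hl]; simp
      · rw [hcoef l hl]; simp
    · rw [hcoef i hi]; simp
  have h := dotProduct_mulVec_add_smul hs w f 1
  rw [one_smul, hBw w hwW, dotProduct_mulVec_symm hs w f, hBw f hfW, hff] at h
  simpa using h

/-- The key step is iterated. Its first use has `W = ⊤` and already costs one coincidence, so `j +
1` steps match `chainSpace k e (j + 1)`. -/
theorem chainSpace_le_nullSet {m : ℕ} {c : (chainGraph k e).edgeSet → ℝ}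
    (hc : chainGram k e ∈ feasibleSet (chainGraph k e) c)
    {ω : Fin m → Fin (3 * k + 1 + e) ⊕ (chainGraph k e).edgeSet → ℝ}
    (hn : IsNestedPSD fun j => stressMatrix (chainGraph k e) (ω j))
    (hd : ∀ j, dualValue (chainGraph k e) c (ω j) ≤ 0) (j : ℕ) (hj : j + 1 ≤ m) :
    (chainSpace k e (j + 1) : Set (Fin (3 * k + 1 + e) → ℝ)) ⊆
      nullSet (fun j => stressMatrix (chainGraph k e) (ω j)) (j + 1) := by
  induction j with
  | zero =>
    intro x hx
    rw [mem_nullSet_succ hj, nullSet_zero]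
    refine ⟨trivial, ?_⟩
    have hd0 := hd ⟨0, hj⟩
    rw [dualValue_eq hc] at hd0
    refine dotProduct_mulVec_eq_zero_of_step (W := ⊤) (stressMatrix_isSymm _ _)
      (fun u v => stressMatrix_eq_zero _ _) (fun y _ => ?_) le_top hd0 hx
    exact hn ⟨0, hj⟩ y (by rw [nullSet_zero]; trivial)
  | succ j ih =>
    intro x hx
    rw [mem_nullSet_succ hj]
    have ih := ih (by omega)
    refine ⟨ih (chainSpace_anti (by omega) hx), ?_⟩
    obtain ⟨W, hW⟩ := exists_submodule_nullSet
      (fun i => stressMatrix_isSymm (chainGraph k e) (ω i)) hn (j + 1) (by omega)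
    have hd0 := hd ⟨j + 1, hj⟩
    rw [dualValue_eq hc] at hd0
    refine dotProduct_mulVec_eq_zero_of_step (W := W) (stressMatrix_isSymm _ _)
      (fun u v => stressMatrix_eq_zero _ _) (fun y hy => ?_) ?_ hd0 hx
    · refine hn ⟨j + 1, hj⟩ y ?_
      rw [← SetLike.mem_coe, hW] at hy
      exact hy
    · rw [← SetLike.coe_subset_coe, hW]
      exact ih

end ChainLowerBound

/-! ### Feasible matrices of the chain and the maximal rank. -/

section ChainFeasible

variable {k e : ℕ}

theorem chainGram_isSymm : (chainGram k e).IsSymm := by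
  ext u v
  simp only [transpose_apply, chainGram_apply, mul_comm]

theorem dotProduct_chainGram_mulVec (x : Fin (3 * k + 1 + e) → ℝ) :
    x ⬝ᵥ (chainGram k e *ᵥ x) =
      (axisVec k e ⬝ᵥ x) ^ 2 + 3 / 4 * ∑ i : Fin k, (spinVec e i ⬝ᵥ x) ^ 2 := by
  simp only [chainGram, add_mulVec, sum_mulVec, smul_mulVec, vecMulVec_mulVec, dotProduct_add,
    dotProduct_sum, dotProduct_smul, Finset.mul_sum]
  congr 1
  · simp [dotProduct_comm x, sq]
  · refine Finset.sum_congr rfl fun i _ => ?_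
    simp [dotProduct_comm x, sq]

theorem chainGram_posSemidef : (chainGram k e).PosSemidef := by
  refine PosSemidef.of_dotProduct_mulVec_nonneg ?_ fun x => ?_
  · rw [IsHermitian, conjTranspose_eq_transpose_of_trivial]
    exact chainGram_isSymm
  · rw [star_trivial, dotProduct_chainGram_mulVec]
    positivity

theorem chainGram_self (v : Fin (3 * k + 1 + e)) : chainGram k e v v = 1 := by
  rcases vertex_cases v with rfl | ⟨i, rfl⟩ | ⟨i, rfl⟩ | ⟨i, rfl⟩ | hv
  · simp [chainGram_apply]
  · simp [chainGram_apply]; norm_num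
  · simp [chainGram_apply]; norm_num
  · simp [chainGram_apply]
  · simp [chainGram_apply, axisVec_pendant hv, spinVec_pendant _ hv]

variable (k e) in
/-- The edge weights of the chain configuration. -/
noncomputable def chainWeight : (chainGraph k e).edgeSet → ℝ :=
  edgeEntries (chainGraph k e) (chainGram k e) chainGram_isSymm

theorem chainGram_mem : chainGram k e ∈ feasibleSet (chainGraph k e) (chainWeight k e) :=
  ⟨⟨chainGram_posSemidef, chainGram_self⟩, fun _ _ _ => rfl⟩

/-- Unit vectors with inner product 1 coincide: the difference of the coordinate vectors lies in the
kernel. -/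
theorem PosSemidef.mulVec_apply_eq_of_apply_eq_one {V : Type*} [Fintype V] {X : Matrix V V ℝ}
    (hX : X.PosSemidef) (h1 : ∀ i, X i i = 1) {p q : V} (h : X p q = 1) (y : V → ℝ) :
    (X *ᵥ y) p = (X *ᵥ y) q := by
  have hs : X.IsSymm := by
    have := hX.1
    rwa [IsHermitian, conjTranspose_eq_transpose_of_trivial] at this
  have hz : X *ᵥ (Pi.single p 1 - Pi.single q 1) = 0 := by
    rw [← hX.dotProduct_mulVec_zero_iff, star_trivial]
    have := hs.apply p q
    simp [mulVec_sub, sub_dotProduct, h1, h, this]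
  have := dotProduct_mulVec_symm hs (Pi.single p 1 - Pi.single q 1) y
  rw [hz] at this
  simp [sub_dotProduct] at this
  linarith

/-- Three unit vectors at mutual angles of 120 degrees sum to zero, since the squared norm of the
sum is `3 - 3`. -/
theorem PosSemidef.mulVec_apply_add_eq_zero {V : Type*} [Fintype V] {X : Matrix V V ℝ}
    (hX : X.PosSemidef) (h1 : ∀ i, X i i = 1) {p q r : V} (hpq : X p q = -1 / 2)
    (hpr : X p r = -1 / 2) (hqr : X q r = -1 / 2) (y : V → ℝ) :
    (X *ᵥ y) p + (X *ᵥ y) q + (X *ᵥ y) r = 0 := by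
  have hs : X.IsSymm := by
    have := hX.1
    rwa [IsHermitian, conjTranspose_eq_transpose_of_trivial] at this
  have hz : X *ᵥ (Pi.single p 1 + Pi.single q 1 + Pi.single r 1) = 0 := by
    rw [← hX.dotProduct_mulVec_zero_iff, star_trivial]
    have e1 := hs.apply p q
    have e2 := hs.apply p r
    have e3 := hs.apply q r
    simp [mulVec_add, add_dotProduct, h1, hpq, hpr, hqr, e1, e2, e3]
    norm_num
  have := dotProduct_mulVec_symm hs (Pi.single p 1 + Pi.single q 1 + Pi.single r 1) y
  rw [hz] at this
  simpa [add_dotProduct] using this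

section Edges

variable (i : Fin k)

theorem chainGraph_adj_AB : (chainGraph k e).Adj (vA e i) (vB e i) := by
  have := i.2
  rw [chainGraph_adj]
  have h₁ : (vA e i : ℕ) = 3 * i + 1 := rfl
  have h₂ : (vB e i : ℕ) = 3 * i + 2 := rfl
  exact Or.inl (Or.inl ⟨by omega, by omega⟩)

theorem chainGraph_adj_AZ : (chainGraph k e).Adj (vA e i) (vZ e i) := by
  have := i.2
  rw [chainGraph_adj]
  have h₁ : (vA e i : ℕ) = 3 * i + 1 := rfl
  have h₂ : (vZ e i : ℕ) = 3 * i + 3 := rfl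
  exact Or.inl (Or.inl ⟨by omega, by omega⟩)

theorem chainGraph_adj_BZ : (chainGraph k e).Adj (vB e i) (vZ e i) := by
  have := i.2
  rw [chainGraph_adj]
  have h₁ : (vB e i : ℕ) = 3 * i + 2 := rfl
  have h₂ : (vZ e i : ℕ) = 3 * i + 3 := rfl
  exact Or.inl (Or.inl ⟨by omega, by omega⟩)

theorem chainGraph_adj_hubA : (chainGraph k e).Adj (hub e) (vA e i) := by
  have := i.2
  rw [chainGraph_adj]
  have h₁ : (hub e : Fin (3 * k + 1 + e)).val = 0 := rfl
  have h₂ : (vA e i : ℕ) = 3 * i + 1 := rfl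
  exact Or.inl (Or.inl ⟨by omega, by omega⟩)

theorem chainGraph_adj_YB : (chainGraph k e).Adj (vY e i) (vB e i) := by
  have := i.2
  rw [chainGraph_adj]
  have h₁ : (vY e i : ℕ) = 3 * i := rfl
  have h₂ : (vB e i : ℕ) = 3 * i + 2 := rfl
  exact Or.inl (Or.inl ⟨by omega, by omega⟩)

theorem chainGraph_adj_hubZ (hi : (i : ℕ) = 0) : (chainGraph k e).Adj (hub e) (vZ e i) := by
  have := i.2
  rw [chainGraph_adj]
  have h₁ : (hub e : Fin (3 * k + 1 + e)).val = 0 := rfl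
  have h₂ : (vZ e i : ℕ) = 3 * i + 3 := rfl
  exact Or.inl (Or.inl ⟨by omega, by omega⟩)

theorem chainGraph_adj_pendant {v : Fin (3 * k + 1 + e)} (hv : 3 * k < (v : ℕ)) :
    (chainGraph k e).Adj (hub e) v := by
  exact Or.inl (Or.inr ⟨rfl, hv⟩)

end Edges

theorem mulVec_mem_chainSpace {X : Matrix (Fin (3 * k + 1 + e)) (Fin (3 * k + 1 + e)) ℝ}
    (hX : X ∈ feasibleSet (chainGraph k e) (chainWeight k e)) (y : Fin (3 * k + 1 + e) → ℝ) :
    X *ᵥ y ∈ chainSpace k e k := by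
  have hp := hX.1.1
  have h1 := hX.1.2
  have hs : X.IsSymm := by
    have := hX.1.1.1
    rwa [IsHermitian, conjTranspose_eq_transpose_of_trivial] at this
  have hE : ∀ u v, (chainGraph k e).Adj u v → X u v = chainGram k e u v := fun u v h =>
    (hX.2 u v h).trans (chainGram_mem.2 u v h).symm
  have hAB : ∀ i, X (vA e i) (vB e i) = -1 / 2 := fun i => by
    rw [hE _ _ (chainGraph_adj_AB i)]
    simp [chainGram_apply]; norm_num
  have htri : ∀ i y, (X *ᵥ y) (vA e i) + (X *ᵥ y) (vB e i) + (X *ᵥ y) (vZ e i) = 0 := by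
    intro i y
    refine PosSemidef.mulVec_apply_add_eq_zero hp h1 (hAB i) ?_ ?_ y
    · rw [hE _ _ (chainGraph_adj_AZ i)]; simp [chainGram_apply]
    · rw [hE _ _ (chainGraph_adj_BZ i)]; simp [chainGram_apply]
  have hhub : ∀ (m : ℕ) (hm : m < k) (y), (X *ᵥ y) (vZ e ⟨m, hm⟩) = (X *ᵥ y) (hub e) := by
    intro m
    induction m with
    | zero =>
      intro hm y
      refine (PosSemidef.mulVec_apply_eq_of_apply_eq_one hp h1 ?_ y).symm
      rw [hE _ _ (chainGraph_adj_hubZ ⟨0, hm⟩ rfl)]; simp [chainGram_apply]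
    | succ m ih =>
      intro hm y
      -- Applied to a single column, the coincidence of `vZ e m` with the hub supplies the missing
      -- inner product -1/2 of the hub with the next `vB`.
      have hrow := ih (by omega) (Pi.single (vB e ⟨m + 1, hm⟩) 1)
      simp only [mulVec_single_one, col_apply] at hrow
      have hY : vZ e ⟨m, by omega⟩ = vY e ⟨m + 1, hm⟩ := Fin.ext (by simp only [vY, vZ]; omega)
      have := PosSemidef.mulVec_apply_add_eq_zero hp h1 (p := hub e) (q := vA e ⟨m + 1, hm⟩)
        (r := vB e ⟨m + 1, hm⟩) ?_ ?_ (hAB _) y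
      · have := htri ⟨m + 1, hm⟩ y
        linarith
      · rw [hE _ _ (chainGraph_adj_hubA _)]; simp [chainGram_apply]
      · rw [← hrow, hY, hE _ _ (chainGraph_adj_YB _)]; simp [chainGram_apply]
  refine ⟨fun i => htri i y, fun i _ => hhub i i.2 y, fun v hv => ?_⟩
  refine (PosSemidef.mulVec_apply_eq_of_apply_eq_one hp h1 ?_ y).symm
  rw [hE _ _ (chainGraph_adj_pendant hv)]
  simp [chainGram_apply, axisVec_pendant hv]

theorem rank_le_finrank_chainSpace {X : Matrix (Fin (3 * k + 1 + e)) (Fin (3 * k + 1 + e)) ℝ}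
    (hX : X ∈ feasibleSet (chainGraph k e) (chainWeight k e)) :
    X.rank ≤ Module.finrank ℝ (chainSpace k e k) := by
  refine Submodule.finrank_mono ?_
  rintro _ ⟨y, rfl⟩
  exact mulVec_mem_chainSpace hX y

theorem eq_zero_of_mem_chainSpace {y : Fin (3 * k + 1 + e) → ℝ} (hy : y ∈ chainSpace k e k)
    (h0 : y ⬝ᵥ (chainGram k e *ᵥ y) = 0) : y = 0 := by
  rw [dotProduct_chainGram_mulVec] at h0
  have hS : 0 ≤ ∑ i : Fin k, (spinVec e i ⬝ᵥ y) ^ 2 := Finset.sum_nonneg fun i _ => sq_nonneg _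
  have h1 : axisVec k e ⬝ᵥ y = 0 := by nlinarith [sq_nonneg (axisVec k e ⬝ᵥ y)]
  have h2 : ∀ i : Fin k, spinVec e i ⬝ᵥ y = 0 := by
    have : ∑ i : Fin k, (spinVec e i ⬝ᵥ y) ^ 2 = 0 := by rw [h1] at h0; linarith
    intro i
    have := (Finset.sum_eq_zero_iff_of_nonneg fun i _ => sq_nonneg _).1 this i (Finset.mem_univ i)
    exact pow_eq_zero_iff two_ne_zero |>.1 this
  have h3 : y = y (hub e) • axisVec k e := by
    conv_lhs => rw [eq_sum_of_mem_chainSpace hy]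
    have e1 : ∀ i : Fin k, y (vA e i) - y (vB e i) = 0 := fun i => by
      rw [← spinVec_dotProduct, h2]
    have e2 : ∀ i : Fin k, y (vZ e i) - y (hub e) = 0 := fun i => by
      rw [hy.2.1 i i.2, sub_self]
    simp [e1, e2]
  rw [h3, dotProduct_smul, smul_eq_mul, mul_eq_zero] at h1
  rcases h1 with h1 | h1
  · rw [h3, h1, zero_smul]
  · rw [dotProduct_self_eq_zero] at h1
    have := congrFun h1 (hub e)
    simp at this

/-- The kernel of a relative interior point lies in that of `chainGram`, which meets `chainSpace k e
k` trivially; so `X` is injective on this space. -/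
theorem rank_eq_finrank_chainSpace {X : Matrix (Fin (3 * k + 1 + e)) (Fin (3 * k + 1 + e)) ℝ}
    (hX : X ∈ intrinsicInterior ℝ (feasibleSet (chainGraph k e) (chainWeight k e))) :
    X.rank = Module.finrank ℝ (chainSpace k e k) := by
  refine le_antisymm (rank_le_finrank_chainSpace (intrinsicInterior_subset hX)) ?_
  let L : chainSpace k e k →ₗ[ℝ] LinearMap.range X.mulVecLin :=
    X.mulVecLin.rangeRestrict ∘ₗ (chainSpace k e k).subtype
  refine LinearMap.finrank_le_finrank_of_injective (f := L) ?_
  rw [← LinearMap.ker_eq_bot, LinearMap.ker_eq_bot']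
  rintro ⟨y, hy⟩ h
  have hXy : X *ᵥ y = 0 := congrArg Subtype.val h
  exact Subtype.ext (eq_zero_of_mem_chainSpace hy
    (dotProduct_mulVec_eq_zero_of_mem_intrinsicInterior hX chainGram_mem hXy))

theorem le_of_isFacialReduction {m : ℕ}
    {ω : Fin m → Fin (3 * k + 1 + e) ⊕ (chainGraph k e).edgeSet → ℝ}
    (hω : IsFacialReduction (chainGraph k e) (chainWeight k e) ω) : k ≤ m := by
  by_contra! hlt
  obtain ⟨X, hX, hr⟩ := hω.rank_eq
  rw [rank_eq_finrank_chainSpace hX, Set.finrank] at hr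
  set N := nullSet (fun j => stressMatrix (chainGraph k e) (ω j)) m with hN
  have hsub : (chainSpace k e m : Set (Fin (3 * k + 1 + e) → ℝ)) ⊆ N := by
    rcases Nat.eq_zero_or_pos m with rfl | hm
    · rw [hN, nullSet_zero]
      exact Set.subset_univ _
    · obtain ⟨l, rfl⟩ : ∃ l, m = l + 1 := ⟨m - 1, by omega⟩
      exact chainSpace_le_nullSet chainGram_mem hω.nested hω.dualValue_nonpos l le_rfl
  -- With only `m < k` steps, `flexVec e m` remains in the null set but violates the coincidence of
  -- triangle `m`.
  have hlt' : chainSpace k e k < Submodule.span ℝ N := by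
    refine lt_of_le_of_ne (fun x hx => Submodule.subset_span
      (hsub (chainSpace_anti hlt.le hx))) fun h => flexVec_notMem (e := e) ⟨m, hlt⟩ ?_
    rw [h]
    exact Submodule.subset_span (hsub (flexVec_mem le_rfl))
  exact absurd hr (Submodule.finrank_lt_finrank_of_lt hlt').ne'

end ChainFeasible

/-! ### Appending steps to reduction sequences. -/

section Reduction

variable {V : Type*} [Fintype V]

/-- The set `S` is the null set of some facial reduction sequence of `P(G, c)`. -/
def IsReducedTo (G : SimpleGraph V) (c : G.edgeSet → ℝ) (S : Set (V → ℝ)) : Prop :=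
  ∃ (m : ℕ) (ω : Fin m → V ⊕ G.edgeSet → ℝ),
    IsNestedPSD (fun j => stressMatrix G (ω j)) ∧ (∀ j, dualValue G c (ω j) ≤ 0) ∧
      nullSet (fun j => stressMatrix G (ω j)) m = S

variable {G : SimpleGraph V} {c : G.edgeSet → ℝ}

theorem isReducedTo_univ : IsReducedTo G c Set.univ :=
  ⟨0, fun i => i.elim0, fun i => i.elim0, fun i => i.elim0, nullSet_zero⟩

theorem IsReducedTo.extend {S : Set (V → ℝ)} (h : IsReducedTo G c S) (ω' : V ⊕ G.edgeSet → ℝ)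
    (hpos : ∀ x ∈ S, 0 ≤ x ⬝ᵥ (stressMatrix G ω' *ᵥ x)) (hd : dualValue G c ω' ≤ 0) :
    IsReducedTo G c {x | x ∈ S ∧ x ⬝ᵥ (stressMatrix G ω' *ᵥ x) = 0} := by
  obtain ⟨m, ω, hn, hω, rfl⟩ := h
  let ω'' : Fin (m + 1) → V ⊕ G.edgeSet → ℝ := Fin.snoc ω ω'
  have hcast : ∀ i : Fin m, ω'' i.castSucc = ω i := fun i => Fin.snoc_castSucc _ _ _
  have hlast : ω'' (Fin.last m) = ω' := Fin.snoc_last _ _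
  have hnull : ∀ j ≤ m, nullSet (fun j => stressMatrix G (ω'' j)) j =
      nullSet (fun j => stressMatrix G (ω j)) j := by
    intro j hj
    ext x
    constructor
    · intro h i hi
      have := h i.castSucc hi
      beta_reduce at this ⊢
      rwa [hcast] at this
    · intro h i hi
      have := h ⟨i, hi.trans_le hj⟩ hi
      beta_reduce at this ⊢
      rw [← hcast] at this
      exact this
  refine ⟨m + 1, ω'', fun i => ?_, fun i => ?_, ?_⟩
  · induction i using Fin.lastCases with
    | last =>
      intro x hx
      beta_reduce
      rw [hlast]
      rw [Fin.val_last, hnull m le_rfl] at hx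
      exact hpos x hx
    | cast i =>
      intro x hx
      beta_reduce
      rw [hcast]
      rw [Fin.val_castSucc, hnull i i.2.le] at hx
      exact hn i x hx
  · induction i using Fin.lastCases with
    | last => rw [hlast]; exact hd
    | cast i => rw [hcast]; exact hω i
  · ext x
    rw [mem_nullSet_succ (Nat.lt_succ_self m), hnull m le_rfl]
    change _ ∧ x ⬝ᵥ (stressMatrix G (ω'' (Fin.last m)) *ᵥ x) = 0 ↔ _
    rw [hlast]
    rfl

end Reduction

/-! ### A complete reduction sequence for the chain, and the conclusion. -/

section ChainUpperBound

variable {k e : ℕ}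

theorem IsReducedTo.extend_chain {S : Set (Fin (3 * k + 1 + e) → ℝ)}
    (h : IsReducedTo (chainGraph k e) (chainWeight k e) S)
    {M : Matrix (Fin (3 * k + 1 + e)) (Fin (3 * k + 1 + e)) ℝ} (hs : M.IsSymm)
    (hM : ∀ u v, u ≠ v → ¬ (chainGraph k e).Adj u v → M u v = 0)
    (hpos : ∀ x ∈ S, 0 ≤ x ⬝ᵥ (M *ᵥ x)) (haxis : axisVec k e ⬝ᵥ (M *ᵥ axisVec k e) = 0)
    (hspin : ∀ i, spinVec e i ⬝ᵥ (M *ᵥ spinVec e i) = 0) :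
    IsReducedTo (chainGraph k e) (chainWeight k e) {x | x ∈ S ∧ x ⬝ᵥ (M *ᵥ x) = 0} := by
  have hω := stressMatrix_stressOf (chainGraph k e) M hs hM
  have := h.extend (stressOf (chainGraph k e) M hs) (by rwa [hω])
    (by rw [dualValue_eq chainGram_mem, hω, sum_mul_chainGram]; simp [haxis, hspin])
  rwa [hω] at this

theorem dotProduct_vecMulVec_mulVec {V : Type*} [Fintype V] (r s x : V → ℝ) :
    x ⬝ᵥ (vecMulVec r s *ᵥ x) = (r ⬝ᵥ x) * (s ⬝ᵥ x) := by
  simp [vecMulVec_mulVec, dotProduct_comm x, mul_comm]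

theorem IsReducedTo.extend_linear {S : Set (Fin (3 * k + 1 + e) → ℝ)}
    (h : IsReducedTo (chainGraph k e) (chainWeight k e) S) {r : Fin (3 * k + 1 + e) → ℝ}
    (hr : ∀ u v, u ≠ v → ¬ (chainGraph k e).Adj u v → r u * r v = 0)
    (haxis : r ⬝ᵥ axisVec k e = 0) (hspin : ∀ i, r ⬝ᵥ spinVec e i = 0) :
    IsReducedTo (chainGraph k e) (chainWeight k e) {x | x ∈ S ∧ r ⬝ᵥ x = 0} := by
  have := h.extend_chain (M := vecMulVec r r)
    (by ext u v; simp [vecMulVec_apply, mul_comm])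
    (fun u v huv hadj => by rw [vecMulVec_apply]; exact hr u v huv hadj)
    (fun x _ => by rw [dotProduct_vecMulVec_mulVec]; exact mul_self_nonneg _)
    (by rw [dotProduct_vecMulVec_mulVec, haxis, zero_mul])
    (fun i => by rw [dotProduct_vecMulVec_mulVec, hspin, zero_mul])
  simpa only [dotProduct_vecMulVec_mulVec, mul_self_eq_zero] using this

/-- The squares of the linear forms are used one at a time; only existence matters here, not the
length. -/
theorem IsReducedTo.extend_family {S : Set (Fin (3 * k + 1 + e) → ℝ)}
    (h : IsReducedTo (chainGraph k e) (chainWeight k e) S) {ι : Type*} [Fintype ι]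
    {r : ι → Fin (3 * k + 1 + e) → ℝ}
    (hr : ∀ i, ∀ u v, u ≠ v → ¬ (chainGraph k e).Adj u v → r i u * r i v = 0)
    (haxis : ∀ i, r i ⬝ᵥ axisVec k e = 0) (hspin : ∀ i l, r i ⬝ᵥ spinVec e l = 0) :
    IsReducedTo (chainGraph k e) (chainWeight k e) {x | x ∈ S ∧ ∀ i, r i ⬝ᵥ x = 0} := by
  have key : ∀ s : Finset ι, IsReducedTo (chainGraph k e) (chainWeight k e)
      {x | x ∈ S ∧ ∀ i ∈ s, r i ⬝ᵥ x = 0} := by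
    intro s
    induction s using Finset.induction_on with
    | empty => simpa using h
    | insert a s ha ih =>
      convert ih.extend_linear (hr a) (haxis a) (hspin a) using 1
      ext x
      simp only [Finset.mem_insert, forall_eq_or_imp, Set.mem_ofPred_eq]
      tauto
  simpa using key Finset.univ

theorem isReducedTo_chainSpace_zero :
    IsReducedTo (chainGraph k e) (chainWeight k e) (chainSpace k e 0) := by
  have h1 := (isReducedTo_univ (G := chainGraph k e) (c := chainWeight k e)).extend_family
    (r := fun i : Fin k => Pi.single (vA e i) 1 + Pi.single (vB e i) 1 + Pi.single (vZ e i) 1)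
    (fun i u v huv hadj => by
      have hsupp : ∀ u, (Pi.single (vA e i) 1 + Pi.single (vB e i) 1 + Pi.single (vZ e i) 1 :
          Fin (3 * k + 1 + e) → ℝ) u ≠ 0 → u = vA e i ∨ u = vB e i ∨ u = vZ e i := by
        intro u hu
        by_contra! hne
        simp [hne.1, hne.2.1, hne.2.2] at hu
      by_contra hne
      rw [mul_eq_zero, not_or] at hne
      rcases hsupp u hne.1 with rfl | rfl | rfl <;> rcases hsupp v hne.2 with rfl | rfl | rfl <;>
        first
        | exact huv rfl
        | exact hadj (chainGraph_adj_AB i)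
        | exact hadj (chainGraph_adj_AB i).symm
        | exact hadj (chainGraph_adj_AZ i)
        | exact hadj (chainGraph_adj_AZ i).symm
        | exact hadj (chainGraph_adj_BZ i)
        | exact hadj (chainGraph_adj_BZ i).symm)
    (fun i => by simp [add_dotProduct])
    (fun i l => by by_cases h : i = l <;> simp [add_dotProduct, h])
  have h2 := h1.extend_family
    (r := fun v : Fin (3 * k + 1 + e) =>
      if 3 * k < (v : ℕ) then Pi.single v 1 - Pi.single (hub e) 1 else 0)
    (fun w u v huv hadj => by
      by_cases hw : 3 * k < (w : ℕ)
      · have hsupp : ∀ u, (Pi.single w 1 - Pi.single (hub e) 1 :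
            Fin (3 * k + 1 + e) → ℝ) u ≠ 0 → u = w ∨ u = hub e := by
          intro u hu
          by_contra! hne
          simp [hne.1, hne.2] at hu
        rw [if_pos hw]
        by_contra hne
        rw [mul_eq_zero, not_or] at hne
        rcases hsupp u hne.1 with rfl | rfl <;> rcases hsupp v hne.2 with rfl | rfl <;>
          first
          | exact huv rfl
          | exact hadj (chainGraph_adj_pendant hw)
          | exact hadj (chainGraph_adj_pendant hw).symm
      · simp [hw])
    (fun w => by
      by_cases hw : 3 * k < (w : ℕ)
      · simp [hw, sub_dotProduct, axisVec_pendant hw]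
      · simp [hw])
    (fun w l => by
      by_cases hw : 3 * k < (w : ℕ)
      · simp [hw, sub_dotProduct, spinVec_pendant l hw]
      · simp [hw])
  convert h2 using 1
  ext x
  simp only [SetLike.mem_coe, mem_chainSpace, Set.mem_ofPred_eq, Set.mem_univ, true_and,
    add_dotProduct, single_dotProduct, one_mul, Nat.not_lt_zero, false_implies, implies_true]
  refine and_congr_right fun _ => forall_congr' fun v => ?_
  by_cases hv : 3 * k < (v : ℕ)
  · simp [hv, sub_dotProduct, sub_eq_zero]
  · simp [hv]

theorem IsReducedTo.chainSpace_one (hk : 0 < k)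
    (h : IsReducedTo (chainGraph k e) (chainWeight k e) (chainSpace k e 0)) :
    IsReducedTo (chainGraph k e) (chainWeight k e) (chainSpace k e 1) := by
  have h1 := h.extend_linear (r := Pi.single (vZ e ⟨0, hk⟩) 1 - Pi.single (hub e) 1)
    (fun u v huv hadj => by
      have hsupp : ∀ u, (Pi.single (vZ e ⟨0, hk⟩) 1 - Pi.single (hub e) 1 :
          Fin (3 * k + 1 + e) → ℝ) u ≠ 0 → u = vZ e ⟨0, hk⟩ ∨ u = hub e := by
        intro u hu
        by_contra! hne
        simp [hne.1, hne.2] at hu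
      by_contra hne
      rw [mul_eq_zero, not_or] at hne
      rcases hsupp u hne.1 with rfl | rfl <;> rcases hsupp v hne.2 with rfl | rfl <;>
        first
        | exact huv rfl
        | exact hadj (chainGraph_adj_hubZ _ rfl)
        | exact hadj (chainGraph_adj_hubZ _ rfl).symm)
    (by simp [sub_dotProduct]) (fun l => by simp [sub_dotProduct])
  convert h1 using 1
  ext x
  simp only [SetLike.mem_coe, mem_chainSpace, Set.mem_ofPred_eq, Nat.not_lt_zero, false_implies,
    implies_true, true_and, sub_dotProduct, single_dotProduct, one_mul, sub_eq_zero]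
  constructor
  · rintro ⟨h1, h2, h3⟩
    exact ⟨⟨h1, h3⟩, h2 ⟨0, hk⟩ Nat.one_pos⟩
  · rintro ⟨⟨h1, h3⟩, h2⟩
    refine ⟨h1, fun i hi => ?_, h3⟩
    obtain rfl : i = ⟨0, hk⟩ := Fin.ext (by simp only; omega)
    exact h2

/-- The relation `h + a_i + b_i = 0` would be certified by `s sᵀ`, but `h` and `b_i` are not
adjacent. Adding `p qᵀ + q pᵀ` moves that entry to the edge from `vY e i` to `vB e i`, and changes
nothing on the current space, where `q` vanishes. -/
theorem IsReducedTo.chainSpace_succ {j : ℕ} (hj : j + 1 < k)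
    (h : IsReducedTo (chainGraph k e) (chainWeight k e) (chainSpace k e (j + 1))) :
    IsReducedTo (chainGraph k e) (chainWeight k e) (chainSpace k e (j + 2)) := by
  set i : Fin k := ⟨j + 1, hj⟩ with hi
  have hY : vY e i = vZ e ⟨j, by omega⟩ := Fin.ext (by simp only [vY, vZ, hi]; omega)
  set s : Fin (3 * k + 1 + e) → ℝ :=
    Pi.single (hub e) 1 + Pi.single (vA e i) 1 + Pi.single (vB e i) 1 with hs
  set p : Fin (3 * k + 1 + e) → ℝ := Pi.single (vB e i) 1 with hp
  set q : Fin (3 * k + 1 + e) → ℝ := Pi.single (vY e i) 1 - Pi.single (hub e) 1 with hq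
  have hQ : ∀ x, x ⬝ᵥ ((vecMulVec s s + (vecMulVec p q + vecMulVec q p)) *ᵥ x) =
      (x (hub e) + x (vA e i) + x (vB e i)) ^ 2 +
        2 * x (vB e i) * (x (vY e i) - x (hub e)) := by
    intro x
    simp only [add_mulVec, dotProduct_add, dotProduct_vecMulVec_mulVec, hs, hp, hq,
      add_dotProduct, sub_dotProduct, single_dotProduct, one_mul]
    ring
  have hYx : ∀ x ∈ chainSpace k e (j + 1), x (vY e i) = x (hub e) := fun x hx => by
    rw [hY]; exact hx.2.1 _ (by simp only; omega)
  have h1 := h.extend_chain (M := vecMulVec s s + (vecMulVec p q + vecMulVec q p))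
    (by ext u v; simp only [transpose_apply, Matrix.add_apply, vecMulVec_apply]; ring)
    (fun u v huv hadj => by
      have hsupp : ∀ u, u = hub e ∨ u = vA e i ∨ u = vB e i ∨ u = vY e i ∨
          s u = 0 ∧ p u = 0 ∧ q u = 0 := by
        intro u
        by_contra! hne
        obtain ⟨n1, n2, n3, n4, n5⟩ := hne
        simp [hs, hp, hq, n1, n2, n3, n4] at n5
      have hAh : vA e i ≠ hub e := by simp [Fin.ext_iff, vA, hub]
      have hBh : vB e i ≠ hub e := by simp [Fin.ext_iff, vB, hub]
      have hYh : vY e i ≠ hub e := by simp [Fin.ext_iff, vY, hub, hi]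
      have hAB : vA e i ≠ vB e i := by simp [Fin.ext_iff, vA, vB]
      have hAY : vA e i ≠ vY e i := by simp [Fin.ext_iff, vA, vY]
      have hBY : vB e i ≠ vY e i := by simp [Fin.ext_iff, vB, vY]
      simp only [Matrix.add_apply, vecMulVec_apply]
      rcases hsupp u with rfl | rfl | rfl | rfl | ⟨z1, z2, z3⟩
      case inr.inr.inr.inr => simp [z1, z2, z3]
      all_goals
        rcases hsupp v with rfl | rfl | rfl | rfl | ⟨z1, z2, z3⟩
        case inr.inr.inr.inr => simp [z1, z2, z3]
      all_goals first
        | exact absurd rfl huv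
        | exact absurd (chainGraph_adj_AB i) hadj
        | exact absurd (chainGraph_adj_AB i).symm hadj
        | exact absurd (chainGraph_adj_hubA i) hadj
        | exact absurd (chainGraph_adj_hubA i).symm hadj
        | exact absurd (chainGraph_adj_YB i) hadj
        | exact absurd (chainGraph_adj_YB i).symm hadj
        | simp [hs, hp, hq, hAh, hAh.symm, hBh, hBh.symm, hYh, hYh.symm, hAB, hAB.symm, hAY,
            hAY.symm, hBY, hBY.symm])
    (fun x hx => by
      rw [hQ, hYx x hx, sub_self, mul_zero, add_zero]
      exact sq_nonneg _)
    (by rw [hQ]; simp; norm_num)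
    (fun l => by rw [hQ]; by_cases hl : i = l <;> simp [hl])
  convert h1 using 1
  ext x
  simp only [SetLike.mem_coe, Set.mem_ofPred_eq, hQ]
  constructor
  · intro hx
    have hx' := chainSpace_anti (Nat.le_succ (j + 1)) hx
    refine ⟨hx', ?_⟩
    have e1 := hx.2.1 i (by simp only [hi]; omega)
    have e2 := hx.1 i
    have e3 : x (hub e) + x (vA e i) + x (vB e i) = 0 := by linarith
    rw [e3, hYx x hx']
    ring
  · rintro ⟨hx, h0⟩
    rw [hYx x hx, sub_self, mul_zero, add_zero, sq_eq_zero_iff] at h0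
    refine ⟨hx.1, fun l hl => ?_, hx.2.2⟩
    by_cases hlj : (l : ℕ) < j + 1
    · exact hx.2.1 l hlj
    · obtain rfl : l = i := Fin.ext (by simp only [hi]; omega)
      have := hx.1 i
      linarith

theorem isReducedTo_chainSpace (hk : 0 < k) :
    IsReducedTo (chainGraph k e) (chainWeight k e) (chainSpace k e k) := by
  have key : ∀ j, j + 1 ≤ k →
      IsReducedTo (chainGraph k e) (chainWeight k e) (chainSpace k e (j + 1)) := by
    intro j
    induction j with
    | zero => exact fun _ => isReducedTo_chainSpace_zero.chainSpace_one hk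
    | succ j ih => exact fun hj => (ih (by omega)).chainSpace_succ hj
  have := key (k - 1) (by omega)
  rwa [Nat.sub_add_cancel hk] at this

theorem le_sd_chainGraph (hk : 0 < k) : k ≤ sd (chainGraph k e) := by
  have hc : chainWeight k e ∈ coordinateShadow (chainGraph k e) := ⟨_, chainGram_mem⟩
  refine le_trans ?_ (sdWeight_le_sd hc)
  -- The remaining goal is that a complete sequence exists at all.
  refine le_csInf ?_ fun m ⟨ω, hω⟩ => le_of_isFacialReduction hω
  obtain ⟨m, ω, hn, hd, hS⟩ := isReducedTo_chainSpace (e := e) hk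
  obtain ⟨X, hX⟩ := intrinsicInterior_feasibleSet_nonempty hc
  refine ⟨m, ω, hn, hd, X, hX, ?_⟩
  rw [hS, rank_eq_finrank_chainSpace hX, Set.finrank, Submodule.span_eq]

theorem exists_treewidth_three_le_sd (n : ℕ) (hn : 4 ≤ n) :
    ∃ G : SimpleGraph (Fin n), treewidth G = 3 ∧ (n - 1) / 3 ≤ sd G := by
  obtain ⟨k, e, hk, he, rfl⟩ : ∃ k e, 0 < k ∧ e < 3 ∧ n = 3 * k + 1 + e :=
    ⟨(n - 1) / 3, (n - 1) % 3, by omega, by omega, by omega⟩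
  refine ⟨chainGraph k e, treewidth_chainGraph k e hk, le_trans ?_ (le_sd_chainGraph hk)⟩
  omega

end ChainUpperBound

end PSDCompletion

theorem corollary7p2 :
    (∀ n : ℕ, 4 ≤ n → ∃ G : SimpleGraph (Fin n),
      PSDCompletion.treewidth G = 3 ∧ (n - 1) / 3 ≤ PSDCompletion.sd G) ∧
    ¬ ∃ f : ℕ → ℝ,
      Asymptotics.IsLittleO Filter.atTop f (fun n : ℕ => (n : ℝ)) ∧
      ∀ (n : ℕ) (G : SimpleGraph (Fin n)), (PSDCompletion.sd G : ℝ) ≤ f n := by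
  refine ⟨PSDCompletion.exists_treewidth_three_le_sd, ?_⟩
  rintro ⟨f, hf, hsd⟩
  -- With `sd ≤ n / 10`, the bound `n ≤ 3 sd + 3` fails for `n ≥ 10`.
  have h := hf.def (c := 1 / 10) (by norm_num)
  obtain ⟨n, hn, hn4⟩ := (h.and (Filter.eventually_ge_atTop 10)).exists
  obtain ⟨G, -, hG⟩ := PSDCompletion.exists_treewidth_three_le_sd n (by omega)
  have h1 := hsd n G
  have h2 : n ≤ 3 * PSDCompletion.sd G + 3 := by omega
  have h3 : (n : ℝ) ≤ 3 * PSDCompletion.sd G + 3 := by exact_mod_cast h2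
  have h4 : (10 : ℝ) ≤ n := by exact_mod_cast hn4
  rw [Real.norm_eq_abs, Real.norm_eq_abs, Nat.abs_cast] at hn
  have h5 := le_abs_self (f n)
  linarith
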